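/- Let $F$ be a free group of finite rank $n\ge 2$, let $\mathcal M\subset F$ be a finite set of nontrivial elements, and let $\partial F$ be the boundary at infinity of the Cayley tree of $F$ with respect to a free basis. For $g\neq 1$ let $g^{\pm\infty}=\lim_k g^{\pm k}\in\partial F$. Let $\mathcal D$ be the decomposition space of $\mathcal M$, i.e. the quotient of $\partial F$ obtained by identifying $hw^{\infty}$ with $hw^{-\infty}$ for all $w\in\mathcal M$ and $h\in F$, with quotient map $\delta$ and the induced action of $F$. Assume that $\mathcal D$ is connected. A cut set is a subset of $\mathcal D$ whose complement is not connected; $S$ crosses $T$ if two points of $S$ lie in different connected components of $\mathcal D\setminus T$. Let $\{S_i\}_{i\in I}$ be a non-empty collection of cut sets in $\mathcal D$, invariant under the action of $F$, such that 1. for each $i\in I$ there is given a nontrivial $g_i\in F$ with $S_i=\delta(\{g_i^{-\infty},g_i^{\infty}\})$; 2. no $S_i$ crosses an $S_j$; 3. $\{S_i\}_{i\in I}$ is a union of finitely many $F$-orbits. Then $F$ splits non-trivially as a finite graph of groups relative to $\mathcal M$ with cyclic edge groups: there is a simplicial tree $T$ on which $F$ acts without inversions, without a global fixed vertex, and with finitely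 many orbits of vertices and edges (the Bass–Serre tree of the splitting), such that all edge stabilizers are cyclic and every $w\in\mathcal M$ fixes a vertex of $T$ (that is, is conjugate into a vertex group). Moreover, $T$ is bipartite with two $F$-invariant classes of vertices, called Type 1 and Type 2. The Type 1 vertices are in $F$-equivariant bijection with the sets in $\{S_i\}_{i\in I}$, and the vertex corresponding to $S_i$ is stabilized by the maximal cyclic subgroup of $F$ containing $g_i$. The stabilizers of Type 2 vertices are non-cyclic. -/

import Mathlib

open Filter Set
open scoped Pointwise

/-- The free group of rank `n`. -/
abbrev FreeGrp (n : ℕ) : Type := FreeGroup (Fin n)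

/-- The inverse of a letter `b` or `b⁻¹` of the free basis (`(b, true)` stands for `b`,
`(b, false)` for `b⁻¹`). -/
def invLetter {n : ℕ} (x : Fin n × Bool) : Fin n × Bool := (x.1, !x.2)

theorem invLetter_invLetter {n : ℕ} (x : Fin n × Bool) : invLetter (invLetter x) = x := by
  simp [invLetter]

/-- The boundary at infinity of the Cayley tree of the free group: a point is a geodesic ray
issued from the identity vertex, that is, an infinite reduced word. -/
def FreeBoundary (n : ℕ) : Type :=
  {ξ : ℕ → Fin n × Bool // ∀ k, ξ (k + 1) ≠ invLetter (ξ k)}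

namespace FreeBoundary

/-- The topology of the boundary is that of pointwise convergence of rays, induced by the
product topology on the infinite words over a finite discrete alphabet. -/
instance (n : ℕ) : TopologicalSpace (FreeBoundary n) :=
  inferInstanceAs
    (TopologicalSpace {ξ : ℕ → Fin n × Bool // ∀ k, ξ (k + 1) ≠ invLetter (ξ k)})

/-- Delete the first letter of an infinite reduced word. -/
def tail {n : ℕ} (ξ : FreeBoundary n) : FreeBoundary n :=
  ⟨fun k => ξ.1 (k + 1), fun k => ξ.2 (k + 1)⟩

/-- Prepend a letter that does not cancel against the first letter. -/
def cons {n : ℕ} (x : Fin n × Bool) (ξ : FreeBoundary n) (h : ξ.1 0 ≠ invLetter x) :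
    FreeBoundary n :=
  ⟨fun k => Nat.casesOn k x ξ.1, fun k => by
    cases k with
    | zero => exact h
    | succ k => exact ξ.2 k⟩

/-- Left multiplication of an infinite reduced word by a letter, followed by reduction. -/
def letterMul {n : ℕ} (x : Fin n × Bool) (ξ : FreeBoundary n) : FreeBoundary n :=
  if h : ξ.1 0 = invLetter x then tail ξ else cons x ξ h

theorem letterMul_letterMul {n : ℕ} (x : Fin n × Bool) (ξ : FreeBoundary n) :
    letterMul (invLetter x) (letterMul x ξ) = ξ := by
  by_cases h : ξ.1 0 = invLetter x
  · have h1 : letterMul x ξ = tail ξ := dif_pos h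
    have h2 : ¬ (tail ξ).1 0 = invLetter (invLetter x) := by
      rw [← h]
      exact ξ.2 0
    rw [h1, letterMul, dif_neg h2]
    apply Subtype.ext
    funext k
    cases k with
    | zero => exact h.symm
    | succ k => rfl
  · have h1 : letterMul x ξ = cons x ξ h := dif_neg h
    have h2 : (cons x ξ h).1 0 = invLetter (invLetter x) := (invLetter_invLetter x).symm
    rw [h1, letterMul, dif_pos h2]
    rfl

/-- The permutation of the boundary given by an element of the free basis. -/
def basisPerm {n : ℕ} (b : Fin n) : Equiv.Perm (FreeBoundary n) where
  toFun := letterMul (b, true)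
  invFun := letterMul (b, false)
  left_inv ξ := letterMul_letterMul (b, true) ξ
  right_inv ξ := letterMul_letterMul (b, false) ξ

/-- The action of the free group on its boundary. -/
instance (n : ℕ) : MulAction (FreeGrp n) (FreeBoundary n) :=
  MulAction.compHom (FreeBoundary n)
    (FreeGroup.lift basisPerm : FreeGrp n →* Equiv.Perm (FreeBoundary n))

end FreeBoundary

/-- The sequence `u` of vertices of the Cayley tree converges to the boundary point `ξ`: every
initial segment of the ray `ξ` is eventually an initial segment of the reduced word of `u k`. -/
def ConvergesTo {n : ℕ} (u : ℕ → FreeGrp n) (ξ : FreeBoundary n) : Prop :=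
  ∀ m : ℕ, ∀ᶠ k in atTop, List.ofFn (fun j : Fin m => ξ.1 j) <+: (u k).toWord

/-- The set `{g^{-∞}, g^∞}` of the endpoints of the axis of `g`. -/
def axisEnds {n : ℕ} (g : FreeGrp n) : Set (FreeBoundary n) :=
  {ξ | ConvergesTo (fun k => g ^ k) ξ ∨ ConvergesTo (fun k => g⁻¹ ^ k) ξ}

/-- Two boundary points are endpoints of a common line of the line pattern generated by `M`: the
lines are the translates, by elements `h` of the group, of the axes of the words `w` of `M`. -/
def LineRel {n : ℕ} (M : Finset (FreeGrp n)) (ξ η : FreeBoundary n) : Prop :=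
  ∃ w ∈ M, ∃ h : FreeGrp n, ξ ∈ h • axisEnds w ∧ η ∈ h • axisEnds w

/-- The decomposition space of the multiword `M`: the quotient of the boundary of the free group
by the identification of the two endpoints of each line of the line pattern. -/
def DecompositionSpace {n : ℕ} (M : Finset (FreeGrp n)) : Type := Quot (LineRel M)

namespace DecompositionSpace

instance {n : ℕ} (M : Finset (FreeGrp n)) : TopologicalSpace (DecompositionSpace M) :=
  inferInstanceAs (TopologicalSpace (Quot (LineRel M)))

/-- The quotient map `δ` from the boundary onto the decomposition space. -/
def proj {n : ℕ} (M : Finset (FreeGrp n)) (ξ : FreeBoundary n) : DecompositionSpace M :=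
  Quot.mk _ ξ

theorem lineRel_smul {n : ℕ} (M : Finset (FreeGrp n)) (f : FreeGrp n) (ξ η : FreeBoundary n)
    (hr : LineRel M ξ η) : LineRel M (f • ξ) (f • η) := by
  obtain ⟨w, hw, h, h1, h2⟩ := hr
  refine ⟨w, hw, f * h, ?_, ?_⟩
  · rw [mul_smul]
    exact smul_mem_smul_set h1
  · rw [mul_smul]
    exact smul_mem_smul_set h2

/-- The induced action of the free group on the decomposition space. -/
instance {n : ℕ} (M : Finset (FreeGrp n)) : MulAction (FreeGrp n) (DecompositionSpace M) where
  smul f := Quot.map (fun ξ => f • ξ) (lineRel_smul M f)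
  one_smul x := by
    induction x using Quot.ind with
    | mk ξ => exact congrArg (Quot.mk _) (one_smul _ ξ)
  mul_smul f h x := by
    induction x using Quot.ind with
    | mk ξ => exact congrArg (Quot.mk _) (mul_smul f h ξ)

end DecompositionSpace

/-- A cut set is a set whose complement is not connected. -/
def IsCutSet {X : Type*} [TopologicalSpace X] (S : Set X) : Prop :=
  ¬ IsPreconnected Sᶜ

/-- `S` crosses `T` if two points of `S` lie in different components of the complement
of `T`. -/
def Crosses {X : Type*} [TopologicalSpace X] (S T : Set X) : Prop :=
  ∃ x ∈ S, ∃ y ∈ S, x ∉ T ∧ y ∉ T ∧ y ∉ connectedComponentIn Tᶜ x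

/-- A maximal cyclic subgroup: a cyclic subgroup that is not properly contained in a cyclic
subgroup. -/
def IsMaximalCyclic {G : Type*} [Group G] (H : Subgroup G) : Prop :=
  IsCyclic H ∧ ∀ K : Subgroup G, IsCyclic K → H ≤ K → K = H

/-- A splitting of `G` as a finite graph of groups, given by its Bass-Serre tree: a simplicial
tree on which `G` acts by automorphisms without inversions, with finitely many orbits of vertices
and edges, and without a global fixed vertex (so that the splitting is not trivial).
The vertex groups and the edge groups of the graph of groups are, up to conjugation, the
stabilizers of the vertices and of the edges of the tree. -/
structure Splitting (G : Type*) [Group G] where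
  /-- the vertices of the Bass-Serre tree -/
  V : Type
  /-- the action on the vertices -/
  [action : MulAction G V]
  /-- the Bass-Serre tree -/
  tree : SimpleGraph V
  isTree : tree.IsTree
  adj_smul : ∀ (h : G) (u v : V), tree.Adj u v → tree.Adj (h • u) (h • v)
  no_inversion : ∀ (h : G) (u v : V), tree.Adj u v → ¬ (h • u = v ∧ h • v = u)
  finite_vertex_orbits : ∃ A : Set V, A.Finite ∧ ∀ v, ∃ a ∈ A, ∃ h : G, v = h • a
  finite_edge_orbits : ∃ E : Set (V × V), E.Finite ∧
    ∀ u v, tree.Adj u v → ∃ e ∈ E, ∃ h : G, u = h • e.1 ∧ v = h • e.2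
  no_fixed_vertex : ∀ v : V, ∃ h : G, h • v ≠ v

namespace Splitting

instance {G : Type*} [Group G] (Γ : Splitting G) : MulAction G Γ.V := Γ.action

/-- The stabilizer of a vertex. -/
def vertexGroup {G : Type*} [Group G] (Γ : Splitting G) (v : Γ.V) : Subgroup G :=
  MulAction.stabilizer G v

/-- The stabilizer of the edge joining `u` and `v` (there are no inversions). -/
def edgeGroup {G : Type*} [Group G] (Γ : Splitting G) (u v : Γ.V) : Subgroup G :=
  Γ.vertexGroup u ⊓ Γ.vertexGroup v

/-- The splitting has cyclic edge groups. -/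
def HasCyclicEdgeGroups {G : Type*} [Group G] (Γ : Splitting G) : Prop :=
  ∀ u v, Γ.tree.Adj u v → IsCyclic (Γ.edgeGroup u v)

/-- The splitting is relative to `M`: each element of `M` is conjugate into a vertex group of the
graph of groups, that is, it fixes a vertex of the Bass-Serre tree. -/
def IsRelativeTo {G : Type*} [Group G] (Γ : Splitting G) (M : Finset G) : Prop :=
  ∀ w ∈ M, ∃ v, w ∈ Γ.vertexGroup v

end Splitting

/-! Call the distinct sets among the `S i` walls. Distinct walls are disjoint and do not cross, so
each wall lies in a single component of the complement of any other; these components are the sides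
of a wall. The required tree is dual to this system. Type 1 vertices are the walls. Type 2 vertices,
the stars, choose one side of each wall so that, for some wall `S`, every other wall is oriented
towards `S`; such a star is adjacent to `S`.

Three facts about the decomposition space make this work. A wall has finitely many sides, and they
are open (`SatClopen.finite`, `isOpen_connectedComponentIn`): only finitely many lines of the
pattern cross a clopen half-space `H` around one end of the axis, and connectedness together with
north-south dynamics forces a saturated clopen subset of the complement of the axis to be determined
by its trace on these lines. Only finitely many walls separate two given walls
(`DecompositionSpace.finite_separating`): a long translating element, chosen shortest in its coset,
sends an end of each into the same small cylinder, which lies inside one component. Finally, if `R`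
separates `S` from `T`, then `R` and `T` are on the same side of `S` (`wallSide_eq_of_ne`), because
every side of `R` accumulates on `R`.

From there on the argument is combinatorial and takes place in a `SideSystem`. Induction on the
number of separating walls connects the graph, and every edge is a bridge since a wall cuts the
graph into its sides.

The stabilizer of a wall is the centralizer of its axis element, which is maximal cyclic. A star has
two adjacent walls, and powers of their noncommuting axis elements fix it, so its stabilizer is not
cyclic. For `w ∈ M` the two ends of the axis become one point fixed by `w`; either it lies on a
wall, which `w` then preserves, or it orients all the walls and so defines a star fixed by `w`. -/

theorem ne_invLetter_iff {n : ℕ} {a b : Fin n × Bool} :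
    b ≠ invLetter a ↔ (a.1 = b.1 → a.2 = b.2) := by
  obtain ⟨a, s⟩ := a
  obtain ⟨b, t⟩ := b
  cases s <;> cases t <;> simp [invLetter, Prod.ext_iff, eq_comm]

/-! ### Reduced words and their action on infinite words -/

namespace FreeBoundary

variable {n : ℕ}

/-- The initial segment of length `m` of an infinite reduced word. -/
def word (ξ : FreeBoundary n) (m : ℕ) : List (Fin n × Bool) := List.ofFn fun j : Fin m => ξ.1 j

/-- The vertex at distance `m` from the identity on a ray issued from the identity. -/
def vertex (ξ : FreeBoundary n) (m : ℕ) : FreeGrp n := FreeGroup.mk (word ξ m)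

@[simp] theorem word_length (ξ : FreeBoundary n) (m : ℕ) : (word ξ m).length = m := by simp [word]

@[simp] theorem word_zero (ξ : FreeBoundary n) : word ξ 0 = [] := by simp [word]

@[simp] theorem vertex_zero (ξ : FreeBoundary n) : vertex ξ 0 = 1 := by
  simp [vertex, FreeGroup.one_eq_mk]

@[simp] theorem getElem_word (ξ : FreeBoundary n) (m i : ℕ) (h : i < (word ξ m).length) :
    (word ξ m)[i] = ξ.1 i := by simp [word]

theorem word_succ (ξ : FreeBoundary n) (m : ℕ) : word ξ (m + 1) = ξ.1 0 :: word (tail ξ) m := by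
  simp [word, tail, List.ofFn_succ]

theorem word_cons (x : Fin n × Bool) (ξ : FreeBoundary n) (h : ξ.1 0 ≠ invLetter x) (m : ℕ) :
    word (cons x ξ h) (m + 1) = x :: word ξ m := by
  simp [word, cons, List.ofFn_succ]

theorem take_word (ξ : FreeBoundary n) {k m : ℕ} (h : k ≤ m) : (word ξ m).take k = word ξ k := by
  apply List.ext_getElem
  · simp [h]
  · intro i h1 h2
    simp

theorem word_prefix (ξ : FreeBoundary n) {k m : ℕ} (h : k ≤ m) : word ξ k <+: word ξ m := by
  rw [← take_word ξ h]
  exact List.take_prefix _ _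

theorem isReduced_word (ξ : FreeBoundary n) (m : ℕ) : FreeGroup.IsReduced (word ξ m) := by
  rw [FreeGroup.IsReduced, List.isChain_iff_getElem]
  intro i h
  rw [getElem_word, getElem_word]
  exact ne_invLetter_iff.1 (ξ.2 i)

@[simp] theorem toWord_vertex (ξ : FreeBoundary n) (m : ℕ) : (vertex ξ m).toWord = word ξ m := by
  rw [vertex, FreeGroup.toWord_mk, (isReduced_word ξ m).reduce_eq]

theorem apply_eq_of_word_eq {ξ η : FreeBoundary n} {m i : ℕ} (h : word ξ m = word η m)
    (hi : i < m) : ξ.1 i = η.1 i := by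
  have := congrArg (fun l => l[i]?) h
  simpa [word, hi] using this

theorem word_eq_iff {ξ η : FreeBoundary n} {m : ℕ} :
    word ξ m = word η m ↔ ∀ i < m, ξ.1 i = η.1 i := by
  refine ⟨fun h i hi => apply_eq_of_word_eq h hi, fun h => ?_⟩
  apply List.ext_getElem (by simp)
  intro i h1 h2
  simpa using h i (by simpa using h1)

theorem ext_word {ξ η : FreeBoundary n} (h : ∀ m, word ξ m = word η m) : ξ = η :=
  Subtype.ext (funext fun i => apply_eq_of_word_eq (h (i + 1)) i.lt_succ_self)

theorem mk_singleton_smul (x : Fin n × Bool) (ξ : FreeBoundary n) :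
    (FreeGroup.mk [x] : FreeGrp n) • ξ = letterMul x ξ := by
  obtain ⟨b, s⟩ := x
  cases s
  · have h : (FreeGroup.mk [(b, false)] : FreeGrp n) = (FreeGroup.of b)⁻¹ := by
      simp [FreeGroup.of, FreeGroup.inv_mk, FreeGroup.invRev]
    rw [h]
    change (FreeGroup.lift basisPerm (FreeGroup.of b)⁻¹ : Equiv.Perm (FreeBoundary n)) ξ = _
    rw [map_inv, FreeGroup.lift_apply_of]
    rfl
  · change (FreeGroup.lift basisPerm (FreeGroup.of b) : Equiv.Perm (FreeBoundary n)) ξ = _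
    rw [FreeGroup.lift_apply_of]
    rfl

theorem mk_cons (x : Fin n × Bool) (l : List (Fin n × Bool)) :
    (FreeGroup.mk (x :: l) : FreeGrp n) = FreeGroup.mk [x] * FreeGroup.mk l := by
  rw [FreeGroup.mul_mk, List.singleton_append]

theorem mk_invLetter (x : Fin n × Bool) :
    (FreeGroup.mk [invLetter x] : FreeGrp n) = (FreeGroup.mk [x])⁻¹ := by
  simp [FreeGroup.inv_mk, FreeGroup.invRev, invLetter]

/-- An element of the group maps the vertices far away on a ray to the vertices of the image. -/
theorem exists_mul_vertex (h : FreeGrp n) (ξ : FreeBoundary n) :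
    ∃ d e : ℕ, ∀ j, h * vertex ξ (j + d) = vertex (h • ξ) (j + e) := by
  rw [← FreeGroup.mk_toWord (x := h)]
  induction h.toWord with
  | nil => exact ⟨0, 0, fun j => by simp [← FreeGroup.one_eq_mk]⟩
  | cons x l ih =>
    obtain ⟨d, e, hde⟩ := ih
    rw [mk_cons, mul_smul, mk_singleton_smul]
    by_cases hx : ((FreeGroup.mk l : FreeGrp n) • ξ).1 0 = invLetter x
    · refine ⟨d + 1, e, fun j => ?_⟩
      have h1 : letterMul x ((FreeGroup.mk l : FreeGrp n) • ξ) = tail (FreeGroup.mk l • ξ) :=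
        dif_pos hx
      rw [h1, mul_assoc, show j + (d + 1) = (j + 1) + d by ring, hde,
        show j + 1 + e = (j + e) + 1 by ring, vertex, word_succ, hx, mk_cons (invLetter x),
        mk_invLetter, mul_inv_cancel_left, vertex]
    · refine ⟨d, e + 1, fun j => ?_⟩
      have h1 : letterMul x ((FreeGroup.mk l : FreeGrp n) • ξ) = cons x (FreeGroup.mk l • ξ) hx :=
        dif_neg hx
      rw [h1, mul_assoc, hde, ← add_assoc, vertex, vertex, word_cons, ← mk_cons]

/-- Multiplication without cancellation. -/
theorem word_mk_smul {l : List (Fin n × Bool)} {ξ : FreeBoundary n}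
    (h : FreeGroup.IsReduced (l ++ [ξ.1 0])) (j : ℕ) :
    word ((FreeGroup.mk l : FreeGrp n) • ξ) (l.length + j) = l ++ word ξ j := by
  induction l generalizing j with
  | nil => simp [← FreeGroup.one_eq_mk]
  | cons x l ih =>
    have ih' := ih (h.infix ⟨[x], [], by simp⟩)
    have hx : ¬ ((FreeGroup.mk l : FreeGrp n) • ξ).1 0 = invLetter x := by
      have h0 := ih' 1
      rw [word_succ] at h0
      rcases l with _ | ⟨y, l⟩
      · simp only [List.nil_append, word_succ, List.cons.injEq] at h0
        rw [h0.1]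
        simp only [List.cons_append, List.nil_append, FreeGroup.isReduced_cons_cons] at h
        exact ne_invLetter_iff.2 h.1
      · simp only [List.cons_append, List.cons.injEq] at h0
        rw [h0.1]
        simp only [List.cons_append, FreeGroup.isReduced_cons_cons] at h
        exact ne_invLetter_iff.2 h.1
    have h1 : letterMul x ((FreeGroup.mk l : FreeGrp n) • ξ) = cons x (FreeGroup.mk l • ξ) hx :=
      dif_neg hx
    rw [mk_cons, mul_smul, mk_singleton_smul, h1, List.length_cons,
      show l.length + 1 + j = (l.length + j) + 1 by ring, word_cons, ih', List.cons_append]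

theorem isReduced_concat {l : List (Fin n × Bool)} {x y : Fin n × Bool}
    (h : FreeGroup.IsReduced (l ++ [x])) (hy : y ≠ invLetter x) :
    FreeGroup.IsReduced (l ++ [x] ++ [y]) := by
  apply FreeGroup.IsReduced.append_overlap h _ (by simp)
  simpa [FreeGroup.isReduced_cons_cons] using ne_invLetter_iff.1 hy

/-- If a boundary point does not begin with the first `e` letters of the inverse of a reduced
word, then its image begins with all but the last `e - 1` letters of the word. -/
theorem word_mk_smul_eq_take {l : List (Fin n × Bool)} (hl : FreeGroup.IsReduced l)
    {ξ : FreeBoundary n} {e m : ℕ} (he : e ≤ l.length)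
    (h : word ξ e ≠ (FreeGroup.invRev l).take e) (hm : m + e ≤ l.length + 1) :
    word ((FreeGroup.mk l : FreeGrp n) • ξ) m = l.take m := by
  induction l using List.reverseRecOn generalizing ξ e with
  | nil => 
    simp only [List.length_nil, nonpos_iff_eq_zero] at he
    subst he
    simp at h
  | append_singleton l x ih =>
    rcases e with _ | e
    · simp at h
    -- If the last letter cancels, induction applies to `tail ξ` with `e` lowered by one: each
    -- cancellation uses up one letter of the agreement with the inverse word.
    by_cases hx : ξ.1 0 = invLetter x
    · rw [← FreeGroup.mul_mk, mul_smul, mk_singleton_smul]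
      have h1 : letterMul x ξ = tail ξ := dif_pos hx
      simp only [List.length_append, List.length_cons, List.length_nil] at he hm
      have hm' : m + e ≤ l.length + 1 := by omega
      have hne : word (tail ξ) e ≠ (FreeGroup.invRev l).take e := by
        intro h2
        apply h
        rw [word_succ, h2, hx]
        simp [FreeGroup.invRev, invLetter]
      have he0 : e ≠ 0 := by
        rintro rfl
        simp at hne
      rw [h1, ih (hl.infix ⟨[], [x], by simp⟩) (e := e) (by omega) hne hm', List.take_append,
        show m - l.length = 0 by omega]
      simp
    · have h1 := word_mk_smul (isReduced_concat hl hx) 0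
      rw [word_zero, List.append_nil, add_zero] at h1
      rw [← take_word _ (show m ≤ (l ++ [x]).length by omega), h1]

end FreeBoundary

/-! ### Limits of vertices, ends of axes, commuting elements -/

section

variable {n : ℕ}

open FreeBoundary

theorem convergesTo_iff {u : ℕ → FreeGrp n} {ξ : FreeBoundary n} :
    ConvergesTo u ξ ↔ ∀ m : ℕ, ∀ᶠ k in atTop, word ξ m <+: (u k).toWord := Iff.rfl

theorem prefix_toWord_mk_singleton_mul {x : Fin n × Bool} {f : FreeGrp n} {ξ : FreeBoundary n}
    {m : ℕ} (h : word ξ (m + 1) <+: f.toWord) :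
    word (letterMul x ξ) m <+: (FreeGroup.mk [x] * f).toWord := by
  obtain ⟨t, ht⟩ := h
  have hr : FreeGroup.IsReduced f.toWord := FreeGroup.isReduced_toWord
  have hf : f = FreeGroup.mk (ξ.1 0 :: (word (tail ξ) m ++ t)) := by
    rw [← FreeGroup.mk_toWord (x := f), ← ht, word_succ, List.cons_append]
  rw [← ht, word_succ, List.cons_append] at hr
  by_cases hx : ξ.1 0 = invLetter x
  · have h1 : letterMul x ξ = tail ξ := dif_pos hx
    rw [hf, hx, mk_cons (invLetter x), mk_invLetter, mul_inv_cancel_left, FreeGroup.toWord_mk,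
      (hr.infix ⟨[ξ.1 0], [], by simp⟩).reduce_eq, h1]
    exact List.prefix_append _ _
  · have h1 : letterMul x ξ = cons x ξ hx := dif_neg hx
    have h2 : FreeGroup.IsReduced (x :: ξ.1 0 :: (word (tail ξ) m ++ t)) :=
      FreeGroup.isReduced_cons_cons.2 ⟨ne_invLetter_iff.1 hx, hr⟩
    rw [hf, ← mk_cons, FreeGroup.toWord_mk, h2.reduce_eq, h1]
    refine (word_prefix _ m.le_succ).trans ?_
    rw [word_cons]
    refine (List.prefix_cons_inj x).2 ((word_prefix ξ m.le_succ).trans ?_)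
    rw [word_succ, ← List.cons_append]
    exact List.prefix_append _ _

theorem prefix_toWord_mul_mk_singleton {x : Fin n × Bool} {f : FreeGrp n} {ξ : FreeBoundary n}
    {m : ℕ} (h : word ξ (m + 1) <+: f.toWord) :
    word ξ m <+: (f * FreeGroup.mk [x]).toWord := by
  have hr : FreeGroup.IsReduced f.toWord := FreeGroup.isReduced_toWord
  have h0 := h.length_le
  rw [word_length] at h0
  rcases List.eq_nil_or_concat f.toWord with h1 | ⟨l, y, h1⟩
  · simp [h1] at h0
  rw [List.concat_eq_append] at h1
  have hf : f = FreeGroup.mk (l ++ [y]) := by rw [← h1, FreeGroup.mk_toWord]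
  rw [h1] at hr h h0
  have hl : word ξ m <+: l := by
    apply List.prefix_of_prefix_length_le ((word_prefix ξ m.le_succ).trans h)
      (List.prefix_append _ _)
    simp at h0
    simpa using h0
  refine hl.trans ?_
  by_cases hx : x = invLetter y
  · rw [hf, ← FreeGroup.mul_mk, hx, mk_invLetter, mul_inv_cancel_right, FreeGroup.toWord_mk,
      (hr.infix ⟨[], [y], by simp⟩).reduce_eq]
  · rw [hf, FreeGroup.mul_mk, FreeGroup.toWord_mk, (isReduced_concat hr hx).reduce_eq,
      List.append_assoc]
    exact List.prefix_append _ _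

theorem ConvergesTo.mul_left {u : ℕ → FreeGrp n} {ξ : FreeBoundary n} (hu : ConvergesTo u ξ)
    (h : FreeGrp n) : ConvergesTo (fun k => h * u k) (h • ξ) := by
  rw [← FreeGroup.mk_toWord (x := h)]
  induction h.toWord with
  | nil => simpa [← FreeGroup.one_eq_mk] using hu
  | cons x l ih =>
    intro m
    filter_upwards [convergesTo_iff.1 ih (m + 1)] with k hk
    rw [mk_cons, mul_smul, mk_singleton_smul, mul_assoc]
    exact prefix_toWord_mk_singleton_mul hk

/-- A letter on the right changes only the end of a reduced word, so each letter of `h` costs at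
most one letter of a common prefix and the limit stays. -/
theorem ConvergesTo.mul_right {u : ℕ → FreeGrp n} {ξ : FreeBoundary n} (hu : ConvergesTo u ξ)
    (h : FreeGrp n) : ConvergesTo (fun k => u k * h) ξ := by
  rw [← FreeGroup.mk_toWord (x := h)]
  induction h.toWord generalizing u with
  | nil => simpa [← FreeGroup.one_eq_mk] using hu
  | cons x l ih =>
    rw [mk_cons]
    simp_rw [← mul_assoc]
    apply ih
    intro m
    filter_upwards [convergesTo_iff.1 hu (m + 1)] with k hk
    exact prefix_toWord_mul_mk_singleton hk

theorem ConvergesTo.unique {u : ℕ → FreeGrp n} {ξ η : FreeBoundary n} (h1 : ConvergesTo u ξ)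
    (h2 : ConvergesTo u η) : ξ = η := by
  refine ext_word fun m => ?_
  obtain ⟨k, hk1, hk2⟩ := ((convergesTo_iff.1 h1 m).and (convergesTo_iff.1 h2 m)).exists
  exact (List.prefix_of_prefix_length_le hk1 hk2 (by simp)).eq_of_length (by simp)

theorem convergesTo_vertex (ξ : FreeBoundary n) {a : ℕ → ℕ} (ha : Tendsto a atTop atTop) :
    ConvergesTo (fun k => vertex ξ (a k)) ξ := by
  rw [convergesTo_iff]
  intro m
  filter_upwards [ha.eventually_ge_atTop m] with k hk
  rw [toWord_vertex]
  exact word_prefix ξ hk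

/-- An element commuting with `g` fixes the endpoints of the axis of `g`. -/
theorem Commute.smul_eq_of_mem_axisEnds {f g : FreeGrp n} (h : Commute f g) {ξ : FreeBoundary n}
    (hξ : ξ ∈ axisEnds g) : f • ξ = ξ := by
  rcases hξ with hξ | hξ
  · refine (hξ.mul_left f).unique ?_
    simp_rw [(h.pow_right _).eq]
    exact hξ.mul_right f
  · refine (hξ.mul_left f).unique ?_
    simp_rw [(h.inv_right.pow_right _).eq]
    exact hξ.mul_right f

/-- A nontrivial element fixing a boundary point, or its inverse, translates the vertices far away
on the ray towards that point. -/
theorem exists_translation {g : FreeGrp n} (hg : g ≠ 1) {ξ : FreeBoundary n} (h : g • ξ = ξ) :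
    ∃ d l : ℕ, 0 < l ∧ ((∀ j ≥ d, g * vertex ξ j = vertex ξ (j + l)) ∨
      ∀ j ≥ d, g⁻¹ * vertex ξ j = vertex ξ (j + l)) := by
  obtain ⟨d, e, hde⟩ := exists_mul_vertex g ξ
  rw [h] at hde
  rcases lt_trichotomy d e with hlt | rfl | hlt
  · refine ⟨d, e - d, by omega, Or.inl fun j hj => ?_⟩
    have := hde (j - d)
    rwa [show j - d + d = j by omega, show j - d + e = j + (e - d) by omega] at this
  · exact absurd (mul_eq_right.1 (hde 0)) hg
  · refine ⟨e, d - e, by omega, Or.inr fun j hj => ?_⟩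
    have := hde (j - e)
    rw [show j - e + e = j by omega, show j - e + d = j + (d - e) by omega] at this
    rw [← this, inv_mul_cancel_left]

theorem pow_mul_vertex {g : FreeGrp n} {ξ : FreeBoundary n} {d l : ℕ}
    (h : ∀ j ≥ d, g * vertex ξ j = vertex ξ (j + l)) (k : ℕ) {j : ℕ} (hj : d ≤ j) :
    g ^ k * vertex ξ j = vertex ξ (j + k * l) := by
  induction k with
  | zero => simp
  | succ k ih => rw [pow_succ', mul_assoc, ih, h _ (by omega)]; congr 1; ring

theorem convergesTo_pow {g : FreeGrp n} {ξ : FreeBoundary n} {d l : ℕ} (hl : 0 < l)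
    (h : ∀ j ≥ d, g * vertex ξ j = vertex ξ (j + l)) : ConvergesTo (fun k => g ^ k) ξ := by
  have h1 : (fun k => g ^ k) = fun k => vertex ξ (d + k * l) * (vertex ξ d)⁻¹ := by
    funext k
    rw [← pow_mul_vertex h k le_rfl, mul_inv_cancel_right]
  rw [h1]
  refine (convergesTo_vertex ξ ?_).mul_right _
  exact tendsto_atTop_mono (fun k => (Nat.le_mul_of_pos_right k hl).trans (Nat.le_add_left _ _))
    tendsto_id

/-- The endpoints of the axis of a nontrivial element are its fixed points on the boundary. -/
theorem mem_axisEnds_iff {g : FreeGrp n} (hg : g ≠ 1) {ξ : FreeBoundary n} :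
    ξ ∈ axisEnds g ↔ g • ξ = ξ := by
  refine ⟨fun h => (Commute.refl g).smul_eq_of_mem_axisEnds h, fun h => ?_⟩
  obtain ⟨d, l, hl, h1 | h1⟩ := exists_translation hg h
  · exact Or.inl (convergesTo_pow hl h1)
  · exact Or.inr (convergesTo_pow hl h1)

/-- The conjugate of `g` by `f` has the same `m`-th power as `g`, and roots in a free group are
unique. -/
theorem commute_of_commute_pow {f g : FreeGrp n} {m : ℕ} (hm : m ≠ 0) (h : Commute f (g ^ m)) :
    Commute f g := by
  have h1 : (f * g * f⁻¹) ^ m = g ^ m := by rw [conj_pow, h.eq, mul_inv_cancel_right]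
  have h2 := pow_left_injective hm h1
  exact mul_inv_eq_iff_eq_mul.1 h2

/-- Nontrivial elements with a common fixed point on the boundary commute. -/
theorem commute_of_smul_eq {f g : FreeGrp n} {ξ : FreeBoundary n} (hf : f • ξ = ξ)
    (hg : g • ξ = ξ) : Commute f g := by
  rcases eq_or_ne f 1 with rfl | hf1
  · exact Commute.one_left _
  rcases eq_or_ne g 1 with rfl | hg1
  · exact Commute.one_right _
  have key : ∀ {x y : FreeGrp n} {d l d' l' : ℕ}, 0 < l → 0 < l' →
      (∀ j ≥ d, x * vertex ξ j = vertex ξ (j + l)) →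
      (∀ j ≥ d', y * vertex ξ j = vertex ξ (j + l')) → Commute x y := by
    intro x y d l d' l' hl hl' hx hy
    -- Both powers advance a far vertex of the ray by `l * l'`, and the action on vertices is free.
    have h1 : x ^ l' = y ^ l := by
      apply mul_right_cancel (b := vertex ξ (d + d'))
      rw [pow_mul_vertex hx _ (by omega), pow_mul_vertex hy _ (by omega), mul_comm l]
    apply commute_of_commute_pow hl.ne'
    rw [← h1]
    exact (Commute.refl x).pow_right _
  obtain ⟨d, l, hl, h1⟩ := exists_translation hf1 hf
  obtain ⟨d', l', hl', h2⟩ := exists_translation hg1 hg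
  rcases h1 with h1 | h1 <;> rcases h2 with h2 | h2
  · exact key hl hl' h1 h2
  · simpa using (key hl hl' h1 h2).inv_right
  · simpa using (key hl hl' h1 h2).inv_left
  · simpa using (key hl hl' h1 h2).inv_right.inv_left

theorem axisEnds_eq_of_commute {f g : FreeGrp n} (hf : f ≠ 1) (hg : g ≠ 1) (h : Commute f g) :
    axisEnds f = axisEnds g := by
  ext ξ
  constructor
  · intro hξ
    exact (mem_axisEnds_iff hg).2 (h.symm.smul_eq_of_mem_axisEnds hξ)
  · intro hξ
    exact (mem_axisEnds_iff hf).2 (h.smul_eq_of_mem_axisEnds hξ)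

/-- Both elements fix the shared end, hence commute, and commuting nontrivial elements have the same
fixed ends. -/
theorem axisEnds_eq_of_mem {f g : FreeGrp n} (hf : f ≠ 1) (hg : g ≠ 1) {ξ : FreeBoundary n}
    (h1 : ξ ∈ axisEnds f) (h2 : ξ ∈ axisEnds g) : axisEnds f = axisEnds g :=
  axisEnds_eq_of_commute hf hg
    (commute_of_smul_eq ((mem_axisEnds_iff hf).1 h1) ((mem_axisEnds_iff hg).1 h2))

theorem conj_ne_one {g : FreeGrp n} (hg : g ≠ 1) (h : FreeGrp n) : h * g * h⁻¹ ≠ 1 := by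
  simpa [mul_inv_eq_one] using hg

theorem smul_axisEnds {g : FreeGrp n} (hg : g ≠ 1) (h : FreeGrp n) :
    h • axisEnds g = axisEnds (h * g * h⁻¹) := by
  ext ξ
  rw [mem_smul_set_iff_inv_smul_mem, mem_axisEnds_iff hg, mem_axisEnds_iff (conj_ne_one hg h),
    mul_smul, mul_smul, eq_inv_smul_iff]

end

/-! ### Centralizers are maximal cyclic -/

section

open FreeBoundary

/-- Take a generator `y` other than the first one occurring in `z`, with the sign for which `z * y`
does not cancel. The reduced word of `y * z` begins with `y`, that of `z * y` with the first letter
of `z`, so they cannot commute. -/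
theorem FreeGroup.subsingleton_of_mem_center {α : Type*} {z : FreeGroup α} (hz : z ≠ 1)
    (h : ∀ f, Commute f z) : Subsingleton α := by
  classical
  by_contra hα
  rw [not_subsingleton_iff_nontrivial] at hα
  have hr : IsReduced z.toWord := isReduced_toWord
  rcases hw : z.toWord with _ | ⟨c, t⟩
  · exact hz (toWord_eq_nil_iff.1 hw)
  obtain ⟨y, hy⟩ := exists_ne c.1
  obtain ⟨s, hs⟩ : ∃ s, IsReduced (z.toWord ++ [(y, s)]) := by
    rcases List.eq_nil_or_concat z.toWord with h1 | ⟨l, b, h1⟩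
    · simp [hw] at h1
    rw [List.concat_eq_append] at h1
    refine ⟨b.2, ?_⟩
    rw [h1] at hr ⊢
    exact hr.append_overlap (by simp [isReduced_cons_cons]) (by simp)
  have h1 : (FreeGroup.mk [(y, s)] * z).toWord = (y, s) :: z.toWord := by
    have h2 : IsReduced ((y, s) :: z.toWord) := by
      rw [hw] at hr ⊢
      exact isReduced_cons_cons.2 ⟨fun h => absurd h hy, hr⟩
    conv_lhs => rw [← FreeGroup.mk_toWord (x := z), FreeGroup.mul_mk, FreeGroup.toWord_mk]
    exact h2.reduce_eq
  have h2 : (z * FreeGroup.mk [(y, s)]).toWord = z.toWord ++ [(y, s)] := by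
    conv_lhs => rw [← FreeGroup.mk_toWord (x := z), FreeGroup.mul_mk, FreeGroup.toWord_mk]
    exact hs.reduce_eq
  rw [(h _).eq, h2, hw, List.cons_append, List.cons.injEq] at h1
  exact hy (congrArg Prod.fst h1.1).symm

theorem FreeGroup.isCyclic_of_subsingleton {α : Type*} [Subsingleton α] :
    IsCyclic (FreeGroup α) := by
  rcases isEmpty_or_nonempty α with h | ⟨⟨a⟩⟩
  · infer_instance
  · refine ⟨FreeGroup.of a, fun x => ?_⟩
    change x ∈ Subgroup.zpowers (FreeGroup.of a)
    rw [Subgroup.zpowers_eq_closure]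
    have h1 : ({FreeGroup.of a} : Set (FreeGroup α)) = range FreeGroup.of := by
      ext y
      constructor
      · rintro rfl
        exact ⟨a, rfl⟩
      · rintro ⟨b, rfl⟩
        rw [Subsingleton.elim b a]
        rfl
    rw [h1, FreeGroup.closure_range_of]
    trivial

theorem IsFreeGroup.isCyclic_of_mem_center {G : Type*} [Group G] [IsFreeGroup G] {z : G}
    (hz : z ≠ 1) (h : ∀ f, Commute f z) : IsCyclic G := by
  let e := IsFreeGroup.toFreeGroup G
  have := FreeGroup.subsingleton_of_mem_center (z := e z) (by simpa using hz) (fun f => by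
    have := (h (e.symm f)).map e
    simpa using this)
  have := FreeGroup.isCyclic_of_subsingleton (α := IsFreeGroup.Generators G)
  exact isCyclic_of_surjective e.symm e.symm.surjective

variable {n : ℕ}

theorem Subgroup.commute_of_isCyclic {G : Type*} [Group G] {K : Subgroup G} (hK : IsCyclic K)
    {x y : G} (hx : x ∈ K) (hy : y ∈ K) : Commute x y := by
  obtain ⟨c, hc⟩ := hK
  obtain ⟨a, ha⟩ := hc ⟨x, hx⟩
  obtain ⟨b, hb⟩ := hc ⟨y, hy⟩
  have ha' : (c : G) ^ a = x := congrArg Subtype.val ha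
  have hb' : (c : G) ^ b = y := congrArg Subtype.val hb
  rw [← ha', ← hb']
  exact (Commute.refl (c : G)).zpow_zpow a b

/-- The centralizer is free by Nielsen–Schreier and has the nontrivial central element `g`, so it is
cyclic. A cyclic group containing it is abelian and contains `g`, hence centralizes `g`. -/
theorem isMaximalCyclic_centralizer {g : FreeGrp n} (hg : g ≠ 1) :
    IsMaximalCyclic (Subgroup.centralizer {g}) := by
  have hmem : g ∈ Subgroup.centralizer ({g} : Set (FreeGrp n)) := by
    simp [Subgroup.mem_centralizer_singleton_iff]
  refine ⟨?_, fun K hK hle => ?_⟩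
  · refine IsFreeGroup.isCyclic_of_mem_center (z := (⟨g, hmem⟩ : Subgroup.centralizer {g}))
      (by simpa [Subtype.ext_iff] using hg) fun f => ?_
    exact Subtype.ext (Subgroup.mem_centralizer_singleton_iff.1 f.2)
  · refine le_antisymm (fun x hx => ?_) hle
    rw [Subgroup.mem_centralizer_singleton_iff]
    exact Subgroup.commute_of_isCyclic hK hx (hle hmem)

/-! ### Cylinders, compactness and continuity of the action -/

namespace FreeBoundary

theorem isClopen_setOf_apply (k : ℕ) (P : Fin n × Bool → Prop) :
    IsClopen {ξ : FreeBoundary n | P (ξ.1 k)} :=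
  (isClopen_discrete {x | P x}).preimage ((continuous_apply k).comp continuous_subtype_val)

theorem isOpen_setOf_word (l : List (Fin n × Bool)) (m : ℕ) :
    IsOpen {ξ : FreeBoundary n | word ξ m = l} := by
  have h : {ξ : FreeBoundary n | word ξ m = l} =
      ⋃ η ∈ {η : FreeBoundary n | word η m = l}, ⋂ i ∈ Finset.range m, {ξ | ξ.1 i = η.1 i} := by
    ext ξ
    simp only [mem_ofPred_eq, Finset.mem_range, mem_iUnion, mem_iInter, exists_prop]
    constructor
    · exact fun h => ⟨ξ, h, fun _ _ => rfl⟩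
    · rintro ⟨η, h1, h2⟩
      rw [← h1, word_eq_iff]
      exact h2
  rw [h]
  refine isOpen_biUnion fun η _ => isOpen_biInter_finset fun i _ => ?_
  exact (isClopen_setOf_apply i (· = η.1 i)).isOpen

theorem exists_word_subset {U : Set (FreeBoundary n)} (hU : IsOpen U) {ξ : FreeBoundary n}
    (hξ : ξ ∈ U) : ∃ m, {η | word η m = word ξ m} ⊆ U := by
  obtain ⟨V, hV, rfl⟩ := isOpen_induced_iff.1 hU
  obtain ⟨_, ⟨x, m, rfl⟩, h1, h2⟩ :=
    (PiNat.isTopologicalBasis_cylinders (fun _ : ℕ => Fin n × Bool)).isOpen_iff.1 hV ξ.1 hξ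
  refine ⟨m, fun η hη => h2 ?_⟩
  intro i hi
  rw [apply_eq_of_word_eq hη hi]
  exact h1 i hi

instance instCompactSpace : CompactSpace (FreeBoundary n) := by
  have h : IsClosed {ξ : ℕ → Fin n × Bool | ∀ k, ξ (k + 1) ≠ invLetter (ξ k)} := by
    simp only [ofPred_forall]
    refine isClosed_iInter fun k => ?_
    have hc : Continuous fun ξ : ℕ → Fin n × Bool => (ξ k, ξ (k + 1)) :=
      (continuous_apply k).prodMk (continuous_apply (k + 1))
    exact (isClosed_discrete {p : (Fin n × Bool) × (Fin n × Bool) | p.2 ≠ invLetter p.1}).preimage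
      hc
  exact isCompact_iff_compactSpace.1 h.isCompact

/-- A compact set covered by open sets has a depth such that any cylinder of this depth which
meets the compact set is contained in one of the open sets. -/
theorem exists_depth {K : Set (FreeBoundary n)} (hK : IsCompact K)
    {C : Set (Set (FreeBoundary n))} (hC : ∀ U ∈ C, IsOpen U) (hKC : K ⊆ ⋃₀ C) :
    ∃ N, ∀ ξ ∈ K, ∃ U ∈ C, {η | word η N = word ξ N} ⊆ U := by
  choose! c hcC hc using fun ξ (hξ : ξ ∈ K) => mem_sUnion.1 (hKC hξ)
  choose! m hm using fun ξ (hξ : ξ ∈ K) => exists_word_subset (hC _ (hcC ξ hξ)) (hc ξ hξ)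
  obtain ⟨t, htK, ht⟩ := hK.elim_nhds_subcover (fun ξ => {η | word η (m ξ) = word ξ (m ξ)})
    fun ξ _ => (isOpen_setOf_word _ _).mem_nhds rfl
  refine ⟨t.sup m, fun ξ hξ => ?_⟩
  obtain ⟨ζ, hζ, h⟩ := mem_iUnion₂.1 (ht hξ)
  refine ⟨c ζ, hcC ζ (htK ζ hζ), fun η hη => hm ζ (htK ζ hζ) ?_⟩
  have hle : m ζ ≤ t.sup m := Finset.le_sup hζ
  change word η (m ζ) = _
  rw [← take_word η hle, show word η (t.sup m) = word ξ (t.sup m) from hη, take_word ξ hle]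
  exact h

theorem continuous_letterMul (x : Fin n × Bool) : Continuous (letterMul x) := by
  refine continuous_induced_rng.2 (continuous_pi fun k => ?_)
  have h : (fun ξ : FreeBoundary n => (letterMul x ξ).1 k) =
      (fun p : (Fin n × Bool) × (Fin n × Bool) × (Fin n × Bool) =>
        if p.1 = invLetter x then p.2.1 else Nat.casesOn k x fun _ => p.2.2) ∘
      fun ξ => (ξ.1 0, ξ.1 (k + 1), ξ.1 (k - 1)) := by
    funext ξ
    by_cases hx : ξ.1 0 = invLetter x
    · simp [letterMul, hx, tail]
    · cases k <;> simp [letterMul, hx, cons]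
  change Continuous fun ξ : FreeBoundary n => (letterMul x ξ).1 k
  rw [h]
  have hc (i : ℕ) : Continuous fun ξ : FreeBoundary n => ξ.1 i :=
    (continuous_apply i).comp continuous_subtype_val
  exact continuous_of_discreteTopology.comp ((hc 0).prodMk ((hc _).prodMk (hc _)))

instance instContinuousConstSMul : ContinuousConstSMul (FreeGrp n) (FreeBoundary n) := by
  refine ⟨fun f => ?_⟩
  rw [← FreeGroup.mk_toWord (x := f)]
  induction f.toWord with
  | nil => simpa [← FreeGroup.one_eq_mk] using continuous_id'
  | cons x l ih =>
    have h : (fun ξ : FreeBoundary n => (FreeGroup.mk (x :: l) : FreeGrp n) • ξ) =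
        letterMul x ∘ fun ξ => (FreeGroup.mk l : FreeGrp n) • ξ := by
      funext ξ
      rw [mk_cons, mul_smul, mk_singleton_smul]
      rfl
    rw [h]
    exact (continuous_letterMul x).comp ih

end FreeBoundary

end

/-! ### North-south dynamics on the boundary -/

section

open FreeBoundary

variable {n : ℕ}

/-- North-south dynamics of `g` on the boundary with attracting point `p` and repelling point `q`:
the clopen set `H` contains `p` but not `q`, is mapped into itself by `g`, its images under the
positive powers shrink to `p` and its images under the negative powers exhaust the complement
of `q`. -/
structure NorthSouth (g : FreeGrp n) (p q : FreeBoundary n) (H : Set (FreeBoundary n)) : Prop where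
  isClopen : IsClopen H
  mem : p ∈ H
  notMem : q ∉ H
  smul_left : g • p = p
  smul_right : g • q = q
  smul_mem : ∀ ξ ∈ H, g • ξ ∈ H
  attract : ∀ ξ, (∀ k : ℕ, g⁻¹ ^ k • ξ ∈ H) → ξ = p
  repel : ∀ ξ, (∀ k : ℕ, g ^ k • ξ ∉ H) → ξ = q

namespace NorthSouth

variable {g : FreeGrp n} {p q : FreeBoundary n} {H : Set (FreeBoundary n)}

theorem ne (h : NorthSouth g p q H) : p ≠ q := fun hpq => h.notMem (hpq ▸ h.mem)

theorem inv (h : NorthSouth g p q H) : NorthSouth g⁻¹ q p Hᶜ where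
  isClopen := h.isClopen.compl
  mem := h.notMem
  notMem := fun hp => hp h.mem
  smul_left := by rw [inv_smul_eq_iff, h.smul_right]
  smul_right := by rw [inv_smul_eq_iff, h.smul_left]
  smul_mem := fun ξ hξ h1 => hξ (by simpa using h.smul_mem _ h1)
  attract := fun ξ hξ => h.repel ξ (by simpa using hξ)
  repel := fun ξ hξ => h.attract ξ (by simpa using hξ)

theorem conj (h : NorthSouth g p q H) (c : FreeGrp n) :
    NorthSouth (c * g * c⁻¹) (c • p) (c • q) (c • H) where
  isClopen := ⟨h.isClopen.1.smul c, h.isClopen.2.smul c⟩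
  mem := smul_mem_smul_set h.mem
  notMem := fun h1 => h.notMem (smul_mem_smul_set_iff.1 h1)
  smul_left := by simp [mul_smul, h.smul_left]
  smul_right := by simp [mul_smul, h.smul_right]
  smul_mem := fun ξ hξ => by
    rw [mem_smul_set_iff_inv_smul_mem] at hξ ⊢
    simpa [mul_smul] using h.smul_mem _ hξ
  attract := fun ξ hξ => by
    rw [← inv_smul_eq_iff]
    refine h.attract _ fun k => ?_
    have := hξ k
    rw [show (c * g * c⁻¹)⁻¹ = c * g⁻¹ * c⁻¹ by group, conj_pow, mem_smul_set_iff_inv_smul_mem]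
      at this
    simpa [mul_smul] using this
  repel := fun ξ hξ => by
    rw [← inv_smul_eq_iff]
    refine h.repel _ fun k => ?_
    have := hξ k
    rw [conj_pow, mem_smul_set_iff_inv_smul_mem] at this
    simpa [mul_smul] using this

theorem axisEnds_eq (h : NorthSouth g p q H) (hg : g ≠ 1) : axisEnds g = {p, q} := by
  ext ξ
  rw [mem_axisEnds_iff hg, mem_insert_iff, mem_singleton_iff]
  constructor
  · intro hξ
    have h1 : ∀ k : ℕ, g ^ k • ξ = ξ := fun k => by
      induction k with
      | zero => simp
      | succ k ih => rw [pow_succ, mul_smul, hξ, ih]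
    by_cases hH : ξ ∈ H
    · left
      refine h.attract ξ fun k => ?_
      rwa [inv_pow, inv_smul_eq_iff.2 (h1 k).symm]
    · right
      refine h.repel ξ fun k => ?_
      rwa [h1 k]
  · rintro (rfl | rfl)
    exacts [h.smul_left, h.smul_right]

end NorthSouth

theorem toWord_mk_pow {l : List (Fin n × Bool)} (hl : FreeGroup.IsCyclicallyReduced l) (k : ℕ) :
    ((FreeGroup.mk l : FreeGrp n) ^ k).toWord = (List.replicate k l).flatten := by
  rw [FreeGroup.pow_mk, FreeGroup.toWord_mk, (hl.flatten_replicate k).isReduced.reduce_eq]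

theorem length_toWord_mk_pow {l : List (Fin n × Bool)} (hl : FreeGroup.IsCyclicallyReduced l)
    (k : ℕ) : ((FreeGroup.mk l : FreeGrp n) ^ k).toWord.length = k * l.length := by
  rw [toWord_mk_pow hl]
  simp

theorem word_mk_pow_smul {a : Fin n × Bool} {l : List (Fin n × Bool)}
    (hl : FreeGroup.IsCyclicallyReduced (a :: l)) {ξ : FreeBoundary n} (hξ : ξ.1 0 = a) (k : ℕ) :
    word ((FreeGroup.mk (a :: l) : FreeGrp n) ^ k • ξ) (k * (a :: l).length) =
      ((FreeGroup.mk (a :: l) : FreeGrp n) ^ k).toWord := by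
  have hr : FreeGroup.IsReduced ((List.replicate k (a :: l)).flatten ++ [ξ.1 0]) := by
    refine (hl.flatten_replicate (k + 1)).isReduced.infix ⟨[], l, ?_⟩
    simp [List.replicate_succ', hξ]
  have h1 := word_mk_smul hr 0
  rw [word_zero, List.append_nil, add_zero] at h1
  rw [toWord_mk_pow hl, FreeGroup.pow_mk]
  simpa using h1

theorem exists_apply_zero_eq (a : Fin n × Bool) : ∃ ξ : FreeBoundary n, ξ.1 0 = a :=
  ⟨⟨fun _ => a, fun _ => by simp [invLetter, Prod.ext_iff]⟩, rfl⟩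

/-- The images `g ^ k • H` are nested nonempty compact sets; any point of their intersection will
do. -/
theorem exists_forall_inv_pow_smul_mem {g : FreeGrp n} {H : Set (FreeBoundary n)}
    (hH : IsClosed H) (hne : H.Nonempty) (hg : ∀ ξ ∈ H, g • ξ ∈ H) :
    ∃ p, ∀ k : ℕ, g⁻¹ ^ k • p ∈ H := by
  have h1 (k : ℕ) : IsClosed (g ^ k • H) := hH.smul _
  have h2 : (⋂ k : ℕ, g ^ k • H).Nonempty := by
    refine IsCompact.nonempty_iInter_of_sequence_nonempty_isCompact_isClosed _ (fun k => ?_)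
      (fun k => hne.smul_set) (h1 0).isCompact h1
    rw [pow_succ, mul_smul]
    refine smul_set_mono ?_
    rintro _ ⟨ξ, hξ, rfl⟩
    exact hg ξ hξ
  obtain ⟨p, hp⟩ := h2
  refine ⟨p, fun k => ?_⟩
  have := mem_iInter.1 hp k
  rwa [mem_smul_set_iff_inv_smul_mem, ← inv_pow] at this

theorem mk_smul_apply_zero {a : Fin n × Bool} {l : List (Fin n × Bool)}
    (hl : FreeGroup.IsCyclicallyReduced (a :: l)) {ξ : FreeBoundary n} (hξ : ξ.1 0 = a) :
    ((FreeGroup.mk (a :: l) : FreeGrp n) • ξ).1 0 = a := by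
  have h1 := word_mk_pow_smul hl hξ 1
  rw [toWord_mk_pow hl, pow_one, List.length_cons,
    show 1 * (l.length + 1) = l.length + 1 by ring, word_succ] at h1
  simp at h1
  exact h1.1

/-- Compactness of the cylinder of `a` gives the point. All the words of the powers of `a :: l` are
prefixes of it, and their lengths are unbounded, so these prefixes determine it; its image has the
same prefixes, hence it is fixed. -/
theorem exists_attracting {a : Fin n × Bool} {l : List (Fin n × Bool)}
    (hl : FreeGroup.IsCyclicallyReduced (a :: l)) :
    ∃ p : FreeBoundary n, p.1 0 = a ∧ (FreeGroup.mk (a :: l) : FreeGrp n) • p = p ∧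
      ∀ ξ : FreeBoundary n, (∀ k : ℕ, word ξ (k * (a :: l).length) =
        ((FreeGroup.mk (a :: l) : FreeGrp n) ^ k).toWord) → ξ = p := by
  set r : FreeGrp n := FreeGroup.mk (a :: l) with hr
  have h0 : ∀ ξ ∈ {ξ : FreeBoundary n | ξ.1 0 = a}, r • ξ ∈ {ξ : FreeBoundary n | ξ.1 0 = a} :=
    fun ξ hξ => mk_smul_apply_zero hl hξ
  obtain ⟨p, hp⟩ := exists_forall_inv_pow_smul_mem
    (isClopen_setOf_apply 0 (· = a)).isClosed (exists_apply_zero_eq a) h0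
  have hword : ∀ ξ : FreeBoundary n, (∀ k : ℕ, (r⁻¹ ^ k • ξ).1 0 = a) → ∀ k : ℕ,
      word ξ (k * (a :: l).length) = (r ^ k).toWord := fun ξ hξ k => by
    have := word_mk_pow_smul hl (hξ k) k
    rwa [← hr, inv_pow, smul_inv_smul] at this
  have huniq : ∀ ξ : FreeBoundary n, (∀ k : ℕ, word ξ (k * (a :: l).length) = (r ^ k).toWord) →
      ξ = p := fun ξ hξ => by
    refine ext_word fun m => ?_
    have hle : m ≤ m * (a :: l).length := Nat.le_mul_of_pos_right m (by simp)
    rw [← take_word ξ hle, ← take_word p hle, hξ, hword p hp]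
  refine ⟨p, by simpa using hp 0, huniq _ (hword _ fun k => ?_), huniq⟩
  rcases k with _ | k
  · simpa using h0 p (by simpa using hp 0)
  · rw [pow_succ, mul_smul, inv_smul_smul]
    exact hp k

theorem FreeGroup.IsCyclicallyReduced.invRev {α : Type*} {l : List (α × Bool)}
    (hl : FreeGroup.IsCyclicallyReduced l) :
    FreeGroup.IsCyclicallyReduced (FreeGroup.invRev l) := by
  classical
  refine ⟨?_, fun x hx y hy hxy => ?_⟩
  · have h : FreeGroup.invRev l = ((FreeGroup.mk l)⁻¹).toWord := by
      rw [FreeGroup.toWord_inv, FreeGroup.toWord_mk, hl.isReduced.reduce_eq]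
    rw [h]
    exact FreeGroup.isReduced_toWord
  · simp only [FreeGroup.invRev, List.getLast?_reverse, List.head?_map, List.head?_reverse,
      List.getLast?_map, Option.mem_def, Option.map_eq_some_iff] at hx hy
    obtain ⟨x, hx, rfl⟩ := hx
    obtain ⟨y, hy, rfl⟩ := hy
    have := hl.2 y hy x hx hxy.symm
    simp [this]

/-- The half-space is the cylinder of the first letter `a`. If the `k`-th image of a ray misses it,
the whole word of the `k`-th power must have cancelled, or its first letter would survive; so the
ray begins with the word of the inverse power. For all `k` this forces the ray to be the attracting
point `q` of the inverse. -/
theorem exists_northSouth_mk {a : Fin n × Bool} {l : List (Fin n × Bool)}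
    (hl : FreeGroup.IsCyclicallyReduced (a :: l)) :
    ∃ p q H, NorthSouth (FreeGroup.mk (a :: l) : FreeGrp n) p q H := by
  obtain ⟨p, hp, hrp, hpu⟩ := exists_attracting hl
  obtain ⟨b, l', hbl⟩ : ∃ b l', FreeGroup.invRev (a :: l) = b :: l' := by
    apply List.exists_cons_of_ne_nil
    simp [FreeGroup.invRev]
  have hl' : FreeGroup.IsCyclicallyReduced (b :: l') := hbl ▸ hl.invRev
  obtain ⟨q, hq, hrq, hqu⟩ := exists_attracting hl'
  have hinv : (FreeGroup.mk (b :: l') : FreeGrp n) = (FreeGroup.mk (a :: l))⁻¹ := by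
    rw [FreeGroup.inv_mk, hbl]
  have hab : b ≠ a := by
    intro hab
    have h1 := hl.2 (b.1, !b.2) (by
      have := congrArg FreeGroup.invRev hbl
      rw [FreeGroup.invRev_invRev] at this
      rw [this]
      simp [FreeGroup.invRev]) a (by simp) (by simp [hab])
    simp [hab] at h1
  rw [hinv] at hrq hqu
  refine ⟨p, q, {ξ | ξ.1 0 = a}, isClopen_setOf_apply 0 (· = a), hp,
    fun h => hab (hq.symm.trans h), hrp, (inv_smul_eq_iff.1 hrq).symm,
    fun ξ hξ => mk_smul_apply_zero hl hξ, fun ξ hξ => hpu ξ fun k => ?_,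
    fun ξ hξ => hqu ξ fun k => ?_⟩
  · have := word_mk_pow_smul hl (hξ k) k
    rwa [inv_pow, smul_inv_smul] at this
  · by_contra hne
    have hlen : (b :: l').length = (a :: l).length := by rw [← hbl]; simp
    have hr : FreeGroup.IsReduced ((FreeGroup.mk (a :: l) : FreeGrp n) ^ k).toWord :=
      FreeGroup.isReduced_toWord
    have hk : k ≠ 0 := by
      rintro rfl
      simp at hne
    have h2 := word_mk_smul_eq_take hr (ξ := ξ) (e := k * (a :: l).length) (m := 1)
      (by rw [length_toWord_mk_pow hl]) (by
        rw [← FreeGroup.toWord_inv, ← inv_pow, List.take_of_length_le, ← hlen]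
        · exact hne
        · rw [inv_pow, FreeGroup.toWord_inv, FreeGroup.invRev_length, length_toWord_mk_pow hl])
      (by rw [length_toWord_mk_pow hl]; omega)
    rw [FreeGroup.mk_toWord, toWord_mk_pow hl] at h2
    obtain ⟨k, rfl⟩ := Nat.exists_eq_succ_of_ne_zero hk
    rw [List.replicate_succ] at h2
    apply hξ (k + 1)
    simpa [word_succ] using h2

theorem exists_northSouth {g : FreeGrp n} (hg : g ≠ 1) : ∃ p q H, NorthSouth g p q H := by
  have h1 := FreeGroup.reduceCyclically.isCyclicallyReduced
    (FreeGroup.isReduced_toWord (x := g))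
  have h2 := FreeGroup.reduceCyclically.conj_conjugator_reduceCyclically g.toWord
  set c := FreeGroup.reduceCyclically.conjugator g.toWord
  have h3 : g = FreeGroup.mk c * FreeGroup.mk (FreeGroup.reduceCyclically g.toWord) *
      (FreeGroup.mk c)⁻¹ := by
    rw [FreeGroup.inv_mk, FreeGroup.mul_mk, FreeGroup.mul_mk, h2, FreeGroup.mk_toWord]
  rcases h4 : FreeGroup.reduceCyclically g.toWord with _ | ⟨a, l⟩
  · rw [h4, ← FreeGroup.one_eq_mk, mul_one, mul_inv_cancel] at h3
    exact absurd h3 hg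
  · rw [h4] at h1 h3
    obtain ⟨p, q, H, h⟩ := exists_northSouth_mk h1
    rw [h3]
    exact ⟨_, _, _, h.conj _⟩

theorem exists_axisEnds_eq_pair {g : FreeGrp n} (hg : g ≠ 1) :
    ∃ p q, p ≠ q ∧ axisEnds g = {p, q} := by
  obtain ⟨p, q, H, h⟩ := exists_northSouth hg
  exact ⟨p, q, h.ne, h.axisEnds_eq hg⟩

theorem axisEnds_nonempty {g : FreeGrp n} (hg : g ≠ 1) : (axisEnds g).Nonempty := by
  obtain ⟨p, q, -, h⟩ := exists_axisEnds_eq_pair hg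
  exact h ▸ insert_nonempty _ _

theorem finite_axisEnds {g : FreeGrp n} (hg : g ≠ 1) : (axisEnds g).Finite := by
  obtain ⟨p, q, -, h⟩ := exists_axisEnds_eq_pair hg
  exact h ▸ toFinite _

/-- The stabilizer of the axis of `g` is the centralizer of `g`. -/
theorem smul_axisEnds_eq_iff {g : FreeGrp n} (hg : g ≠ 1) (h : FreeGrp n) :
    h • axisEnds g = axisEnds g ↔ Commute h g := by
  constructor
  · intro heq
    obtain ⟨p, q, hpq, hax⟩ := exists_axisEnds_eq_pair hg
    have hp : p ∈ axisEnds g := by simp [hax]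
    have hmem : ∀ ξ ∈ axisEnds g, h • ξ = p ∨ h • ξ = q := fun ξ hξ => by
      have := heq ▸ smul_mem_smul_set (a := h) hξ
      simpa [hax] using this
    -- A priori `h` might exchange the two ends, but its square fixes `p` and so commutes with `g`;
    -- then `h` commutes with `g` as well.
    have h2 : h ^ 2 • p = p := by
      rw [pow_two, mul_smul]
      rcases hmem p hp with h1 | h1
      · rw [h1, h1]
      · rw [h1]
        rcases hmem q (by simp [hax]) with h2 | h2
        · exact h2
        · exact absurd ((smul_left_cancel_iff h).1 (h1.trans h2.symm)) hpq
    exact (commute_of_commute_pow two_ne_zero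
      (commute_of_smul_eq ((mem_axisEnds_iff hg).1 hp) h2)).symm
  · intro hc
    rw [smul_axisEnds hg, hc.eq, mul_inv_cancel_right]

theorem exists_forall_ne_of_card (hn : 2 ≤ n) (x y z : Fin n × Bool) :
    ∃ a, a ≠ x ∧ a ≠ y ∧ a ≠ z := by
  by_contra! h
  have h1 : (Finset.univ : Finset (Fin n × Bool)) ⊆ {x, y, z} := by
    intro a _
    simp only [Finset.mem_insert, Finset.mem_singleton]
    by_contra! h2
    exact h2.2.2 (h a h2.1 h2.2.1)
  have h2 := (Finset.card_le_card h1).trans Finset.card_le_three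
  rw [Finset.card_univ, Fintype.card_prod, Fintype.card_fin, Fintype.card_bool] at h2
  omega

/-- Every open set contains a translate of the pair of endpoints of the axis of `g`. -/
theorem exists_smul_axisEnds_subset (hn : 2 ≤ n) {g : FreeGrp n} (hg : g ≠ 1)
    {U : Set (FreeBoundary n)} (hU : IsOpen U) (hne : U.Nonempty) :
    ∃ h : FreeGrp n, h • axisEnds g ⊆ U := by
  obtain ⟨ξ, hξ⟩ := hne
  obtain ⟨m, hm⟩ := exists_word_subset hU hξ
  obtain ⟨p, q, -, hax⟩ := exists_axisEnds_eq_pair hg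
  -- The buffer letter `a` must not cancel against the prefix of `ξ` or against the first letter of
  -- either end: three forbidden letters, while rank at least two provides four.
  obtain ⟨a, h1, h2, h3⟩ := exists_forall_ne_of_card hn (invLetter (ξ.1 m)) (invLetter (p.1 0))
    (invLetter (q.1 0))
  have hw : word ξ (m + 1) = word ξ m ++ [ξ.1 m] := by
    apply List.ext_getElem (by simp)
    intro i hi hi'
    rw [getElem_word, List.getElem_append]
    split_ifs with him
    · simp
    · rw [List.getElem_singleton]
      rw [word_length] at hi him
      rw [show i = m by omega]
  have hr : FreeGroup.IsReduced (word ξ m ++ [ξ.1 m] ++ [a]) :=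
    isReduced_concat (hw ▸ isReduced_word ξ (m + 1)) h1
  refine ⟨FreeGroup.mk (word ξ m ++ [ξ.1 m] ++ [a]), ?_⟩
  have key : ∀ ζ : FreeBoundary n, a ≠ invLetter (ζ.1 0) →
      (FreeGroup.mk (word ξ m ++ [ξ.1 m] ++ [a]) : FreeGrp n) • ζ ∈ U := by
    intro ζ hζ
    have hζ' : ζ.1 0 ≠ invLetter a := fun h => hζ (by rw [h, invLetter_invLetter])
    have h4 := word_mk_smul (isReduced_concat hr hζ') 0
    apply hm
    change word _ m = word ξ m
    rw [← take_word _ (show m ≤ (word ξ m ++ [ξ.1 m] ++ [a]).length + 0 by simp), h4]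
    simp
  rintro _ ⟨ζ, hζ, rfl⟩
  rw [hax] at hζ
  rcases hζ with rfl | rfl
  · exact key _ h2
  · exact key _ h3

end

/-! ### Lines of the pattern crossing a clopen set -/

section

open FreeBoundary

variable {n : ℕ}

namespace FreeBoundary

/-- Delete the first `m` letters of an infinite reduced word. -/
def drop (ξ : FreeBoundary n) (m : ℕ) : FreeBoundary n :=
  ⟨fun k => ξ.1 (m + k), fun k => ξ.2 (m + k)⟩

theorem word_add (ξ : FreeBoundary n) (m k : ℕ) :
    word ξ (m + k) = word ξ m ++ word (drop ξ m) k := by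
  apply List.ext_getElem (by simp)
  intro i hi hi'
  rw [getElem_word, List.getElem_append]
  split_ifs with him
  · simp
  · rw [word_length] at hi him
    rw [getElem_word]
    change ξ.1 i = ξ.1 (m + (i - (word ξ m).length))
    rw [word_length, show m + (i - m) = i by omega]

theorem vertex_smul_drop (ξ : FreeBoundary n) (m : ℕ) : vertex ξ m • drop ξ m = ξ := by
  refine ext_word fun j => ?_
  have hr : FreeGroup.IsReduced (word ξ m ++ [(drop ξ m).1 0]) := by
    have := isReduced_word ξ (m + 1)
    rwa [word_add, word_succ, word_zero] at this
  have h1 := word_mk_smul hr j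
  rw [word_length, ← word_add] at h1
  rw [← take_word _ (Nat.le_add_left j m), ← take_word ξ (Nat.le_add_left j m), ← h1]
  rfl

end FreeBoundary

theorem FreeGroup.norm_pow_le (w : FreeGrp n) (k : ℕ) : (w ^ k).norm ≤ k * w.norm := by
  induction k with
  | zero => simp
  | succ k ih =>
    rw [pow_succ]
    have := FreeGroup.norm_mul_le (w ^ k) w
    linarith

/-- A translation along a ray has minimal length in its conjugacy class. -/
theorem norm_le_of_mul_vertex {u w y : FreeGrp n} (hu : u = y * w * y⁻¹) {ζ : FreeBoundary n}
    (h : ∀ j, u * vertex ζ j = vertex ζ (j + u.norm)) : u.norm ≤ w.norm := by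
  -- The length of `u ^ k` is exactly linear in `k`, while the conjugator contributes a bounded
  -- amount; a large `k` compares the two rates.
  have h1 : ∀ k : ℕ, k * u.norm ≤ 2 * y.norm + k * w.norm := fun k => by
    have h2 := pow_mul_vertex (d := 0) (fun j _ => h j) k le_rfl
    rw [vertex_zero, mul_one, zero_add] at h2
    have h3 : (u ^ k).norm = k * u.norm := by rw [h2, FreeGroup.norm, toWord_vertex, word_length]
    rw [← h3, hu, conj_pow]
    have h4 := FreeGroup.norm_mul_le (y * w ^ k) y⁻¹
    have h5 := FreeGroup.norm_mul_le y (w ^ k)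
    have h6 := FreeGroup.norm_pow_le w k
    rw [FreeGroup.norm_inv_eq] at h4
    linarith
  by_contra! hlt
  have h7 := h1 (2 * y.norm + 1)
  have h8 := Nat.mul_le_mul_left (2 * y.norm + 1) (Nat.succ_le_of_lt hlt)
  rw [Nat.succ_eq_add_one, mul_add, mul_one] at h8
  omega

theorem mul_vertex_of_smul_eq {v : FreeGrp n} {ξ : FreeBoundary n} (hξ : v • ξ = ξ)
    (hr : FreeGroup.IsReduced (v.toWord ++ [ξ.1 0])) (j : ℕ) :
    v * vertex ξ j = vertex ξ (j + v.norm) := by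
  have h := word_mk_smul hr j
  rw [FreeGroup.mk_toWord, hξ] at h
  rw [add_comm, FreeGroup.norm, vertex, vertex, h, ← FreeGroup.mul_mk, FreeGroup.mk_toWord]

theorem isReduced_toWord_concat {v : FreeGrp n} {x : Fin n × Bool}
    (h : ∀ y ∈ v.toWord.getLast?, x ≠ invLetter y) : FreeGroup.IsReduced (v.toWord ++ [x]) := by
  have hr : FreeGroup.IsReduced v.toWord := FreeGroup.isReduced_toWord
  rcases List.eq_nil_or_concat v.toWord with h1 | ⟨l, y, h1⟩
  · simp [h1]
  · rw [List.concat_eq_append] at h1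
    rw [h1] at hr h ⊢
    exact isReduced_concat hr (h y (by simp))

/-- The two rays start with different letters, so at most one of them cancels against the last
letter of `v`; along the other, `v` is a translation starting at the identity. -/
theorem norm_le_of_apply_zero_ne {v w y : FreeGrp n} (hv : v = y * w * y⁻¹)
    {ξ η : FreeBoundary n} (hξ : v • ξ = ξ) (hη : v • η = η) (hne : ξ.1 0 ≠ η.1 0) :
    v.norm ≤ w.norm := by
  by_cases h1 : ∀ y ∈ v.toWord.getLast?, ξ.1 0 ≠ invLetter y
  · exact norm_le_of_mul_vertex hv (mul_vertex_of_smul_eq hξ (isReduced_toWord_concat h1))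
  · push Not at h1
    obtain ⟨z, hz, hξz⟩ := h1
    refine norm_le_of_mul_vertex hv (mul_vertex_of_smul_eq hη (isReduced_toWord_concat ?_))
    intro z' hz'
    rw [Option.mem_unique hz' hz, ← hξz]
    exact hne.symm

theorem finite_setOf_norm_le (N : ℕ) : {f : FreeGrp n | f.norm ≤ N}.Finite :=
  ((List.finite_length_le (Fin n × Bool) N).preimage FreeGroup.toWord_injective.injOn).subset
    fun _ hf => hf

theorem exists_least_apply_ne {ξ η : FreeBoundary n} {N : ℕ} (h : word ξ N ≠ word η N) :
    ∃ i < N, word ξ i = word η i ∧ ξ.1 i ≠ η.1 i := by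
  classical
  have h1 : ∃ i, i < N ∧ ξ.1 i ≠ η.1 i := by
    by_contra! h2
    exact h (word_eq_iff.2 h2)
  refine ⟨Nat.find h1, (Nat.find_spec h1).1, ?_, (Nat.find_spec h1).2⟩
  rw [word_eq_iff]
  intro i hi
  by_contra h2
  exact Nat.find_min h1 hi ⟨hi.trans (Nat.find_spec h1).1, h2⟩

theorem LineRel.symm {M : Finset (FreeGrp n)} {ξ η : FreeBoundary n} (h : LineRel M ξ η) :
    LineRel M η ξ := by
  obtain ⟨w, hw, f, h1, h2⟩ := h
  exact ⟨w, hw, f, h2, h1⟩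

/-- Only finitely many lines of the pattern cross a clopen subset of the boundary. -/
theorem finite_setOf_crossing {M : Finset (FreeGrp n)} (hM : ∀ w ∈ M, w ≠ 1)
    {H : Set (FreeBoundary n)} (hH : IsClopen H) :
    {ξ | ξ ∈ H ∧ ∃ η, η ∉ H ∧ LineRel M ξ η}.Finite := by
  obtain ⟨N, hN⟩ := exists_depth isCompact_univ (C := {H, Hᶜ})
    (by rintro U (rfl | rfl); exacts [hH.isOpen, hH.compl.isOpen]) (by simp)
  set B := M.sup FreeGroup.norm
  have hfin : (⋃ x ∈ {f : FreeGrp n | f.norm ≤ N}, ⋃ v ∈ {f : FreeGrp n | f.norm ≤ B} \ {1},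
      x • axisEnds v).Finite := by
    refine (finite_setOf_norm_le N).biUnion fun x _ =>
      ((finite_setOf_norm_le B).subset sdiff_subset).biUnion fun v hv => ?_
    exact (finite_axisEnds hv.2).smul_set
  refine hfin.subset ?_
  rintro ξ ⟨hξ, η, hη, w, hw, f, hξw, hηw⟩
  have hne : word ξ N ≠ word η N := by
    intro h
    obtain ⟨U, hU, hsub⟩ := hN ξ (mem_univ _)
    have h1 : ξ ∈ U := hsub rfl
    have h2 : η ∈ U := hsub h.symm
    rcases hU with rfl | rfl
    · exact hη h2
    · exact h1 hξ
  -- The rays to the two ends part after `i < N` letters, at the vertex `x`. Translated by `x⁻¹`,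
  -- the line passes through the identity, so its generator `v` is no longer than `w`. This leaves
  -- finitely many `x` and `v`.
  obtain ⟨i, hi, hpre, hi'⟩ := exists_least_apply_ne hne
  have hw1 := conj_ne_one (hM w hw) f
  rw [smul_axisEnds (hM w hw), mem_axisEnds_iff hw1] at hξw hηw
  set x := vertex ξ i with hx
  have hx' : x = vertex η i := by rw [hx, vertex, vertex, hpre]
  have hξd : x • drop ξ i = ξ := vertex_smul_drop ξ i
  have hηd : x • drop η i = η := by rw [hx']; exact vertex_smul_drop η i
  set v := x⁻¹ * f * w * (x⁻¹ * f)⁻¹ with hv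
  have hv1 : v = x⁻¹ * (f * w * f⁻¹) * x := by rw [hv]; group
  have h1 : v • drop ξ i = drop ξ i := by
    rw [hv1, mul_smul, hξd, mul_smul, hξw, inv_smul_eq_iff, hξd]
  have h2 : v • drop η i = drop η i := by
    rw [hv1, mul_smul, hηd, mul_smul, hηw, inv_smul_eq_iff, hηd]
  have h3 : v.norm ≤ w.norm := norm_le_of_apply_zero_ne hv h1 h2 (by simpa [drop] using hi')
  have hvne : v ≠ 1 := conj_ne_one (hM w hw) _
  simp only [mem_iUnion]
  refine ⟨x, ?_, v, ⟨h3.trans (Finset.le_sup hw), hvne⟩, ?_⟩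
  · change FreeGroup.norm x ≤ N
    rw [hx, FreeGroup.norm, toWord_vertex, word_length]
    exact hi.le
  · rw [← hξd]
    exact smul_mem_smul_set ((mem_axisEnds_iff hvne).2 h1)

/-- Two lines sharing an end have the same two ends. Consequently the quotient map identifies only
ends of a common line. -/
theorem LineRel.trans {M : Finset (FreeGrp n)} (hM : ∀ w ∈ M, w ≠ 1) {ξ η ζ : FreeBoundary n}
    (h1 : LineRel M ξ η) (h2 : LineRel M η ζ) : LineRel M ξ ζ := by
  obtain ⟨w, hw, f, hξ, hη⟩ := h1
  obtain ⟨w', hw', f', hη', hζ⟩ := h2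
  refine ⟨w, hw, f, hξ, ?_⟩
  rw [smul_axisEnds (hM w hw)] at hη ⊢
  rw [smul_axisEnds (hM w' hw')] at hη' hζ
  rwa [axisEnds_eq_of_mem (conj_ne_one (hM w hw) f) (conj_ne_one (hM w' hw') f') hη hη']

/-! ### The quotient map and images of pairs of ends -/

namespace DecompositionSpace

theorem proj_eq_iff {M : Finset (FreeGrp n)} (hM : ∀ w ∈ M, w ≠ 1) {ξ η : FreeBoundary n} :
    proj M ξ = proj M η ↔ ξ = η ∨ LineRel M ξ η := by
  constructor
  · intro h
    have := Quot.eqvGen_exact h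
    induction this with
    | rel x y hxy => exact Or.inr hxy
    | refl x => exact Or.inl rfl
    | symm x y _ ih =>
      rcases ih (Quot.eqvGen_sound ‹_›) with rfl | h
      exacts [Or.inl rfl, Or.inr h.symm]
    | trans x y z _ _ ih1 ih2 =>
      rcases ih1 (Quot.eqvGen_sound ‹_›) with rfl | h1
      · exact ih2 (Quot.eqvGen_sound ‹_›)
      · rcases ih2 (Quot.eqvGen_sound ‹_›) with rfl | h2
        exacts [Or.inr h1, Or.inr (h1.trans hM h2)]
  · rintro (rfl | h)
    exacts [rfl, Quot.sound h]

theorem proj_surjective (M : Finset (FreeGrp n)) : Function.Surjective (proj M) :=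
  Quot.mk_surjective

theorem continuous_proj (M : Finset (FreeGrp n)) : Continuous (proj M) := continuous_quot_mk

theorem isOpen_preimage_proj {M : Finset (FreeGrp n)} {U : Set (DecompositionSpace M)} :
    IsOpen (proj M ⁻¹' U) ↔ IsOpen U :=
  (isQuotientMap_quot_mk (r := LineRel M)).isOpen_preimage

theorem smul_proj (M : Finset (FreeGrp n)) (h : FreeGrp n) (ξ : FreeBoundary n) :
    h • proj M ξ = proj M (h • ξ) := rfl

instance instContinuousConstSMul (M : Finset (FreeGrp n)) :
    ContinuousConstSMul (FreeGrp n) (DecompositionSpace M) :=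
  ⟨fun h => (isQuotientMap_quot_mk (r := LineRel M)).continuous_iff.2
    ((continuous_proj M).comp (continuous_const_smul h))⟩

/-- Two pairs of endpoints of axes that meet in the decomposition space are equal. -/
theorem axisEnds_eq_of_proj_eq {M : Finset (FreeGrp n)} (hM : ∀ w ∈ M, w ≠ 1) {f g : FreeGrp n}
    (hf : f ≠ 1) (hg : g ≠ 1) {ξ η : FreeBoundary n} (hξ : ξ ∈ axisEnds f) (hη : η ∈ axisEnds g)
    (h : proj M ξ = proj M η) : axisEnds f = axisEnds g := by
  rcases (proj_eq_iff hM).1 h with rfl | ⟨w, hw, x, h1, h2⟩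
  · exact axisEnds_eq_of_mem hf hg hξ hη
  · rw [smul_axisEnds (hM w hw)] at h1 h2
    have hw1 := conj_ne_one (hM w hw) x
    exact (axisEnds_eq_of_mem hf hw1 hξ h1).trans (axisEnds_eq_of_mem hw1 hg h2 hη)

theorem preimage_proj_image_axisEnds {M : Finset (FreeGrp n)} (hM : ∀ w ∈ M, w ≠ 1)
    {g : FreeGrp n} (hg : g ≠ 1) : proj M ⁻¹' (proj M '' axisEnds g) = axisEnds g := by
  refine Subset.antisymm ?_ (subset_preimage_image _ _)
  rintro ξ ⟨η, hη, h⟩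
  rcases (proj_eq_iff hM).1 h with rfl | ⟨w, hw, x, h1, h2⟩
  · exact hη
  · rw [smul_axisEnds (hM w hw)] at h1 h2
    rwa [axisEnds_eq_of_mem hg (conj_ne_one (hM w hw) x) hη h1]

theorem smul_image_proj (M : Finset (FreeGrp n)) (h : FreeGrp n) (A : Set (FreeBoundary n)) :
    h • (proj M '' A) = proj M '' (h • A) := by
  rw [← image_smul, ← image_smul, image_image, image_image]
  rfl

end DecompositionSpace

end

/-! ### Components of the complement of a pair of ends -/

section

open FreeBoundary

/-- By finiteness the intersection of the relatively clopen sets containing `x` is again relatively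
clopen. A separation of it would produce a smaller one, so it is connected, and it is the component.
-/
theorem exists_relClopen_eq_connectedComponentIn {X : Type*} [TopologicalSpace X] {F : Set X}
    (hF : {U : Set X | IsOpen U ∧ U ⊆ F ∧ IsOpen (F \ U)}.Finite) (hFo : IsOpen F) {x : X}
    (hx : x ∈ F) :
    connectedComponentIn F x ∈ {U : Set X | IsOpen U ∧ U ⊆ F ∧ IsOpen (F \ U)} := by
  set B := {U : Set X | IsOpen U ∧ U ⊆ F ∧ IsOpen (F \ U)} with hB
  set A := ⋂ U ∈ {U ∈ B | x ∈ U}, U with hA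
  have hfin : {U ∈ B | x ∈ U}.Finite := hF.subset (sep_subset _ _)
  have hFB : F ∈ {U ∈ B | x ∈ U} := ⟨⟨hFo, subset_rfl, by simp⟩, hx⟩
  have hxA : x ∈ A := mem_iInter₂.2 fun U hU => hU.2
  have hAF : A ⊆ F := biInter_subset_of_mem hFB
  have hAo : IsOpen A := hfin.isOpen_biInter fun U hU => hU.1.1
  have hAB : A ∈ B := by
    refine ⟨hAo, hAF, ?_⟩
    have : F \ A = ⋃ U ∈ {U ∈ B | x ∈ U}, F \ U := by
      ext y
      simp only [hA, Set.mem_sdiff, mem_iInter, mem_iUnion, not_forall, exists_prop]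
      constructor
      · rintro ⟨hy, U, hU, hyU⟩
        exact ⟨U, hU, hy, hyU⟩
      · rintro ⟨U, hU, hy, hyU⟩
        exact ⟨hy, U, hU, hyU⟩
    rw [this]
    exact isOpen_biUnion fun U hU => hU.1.2.2
  have hmin : ∀ U ∈ B, x ∈ U → A ⊆ U := fun U hU hxU => biInter_subset_of_mem ⟨hU, hxU⟩
  have hpre : IsPreconnected A := by
    have key : ∀ U V : Set X, IsOpen U → IsOpen V → A ⊆ U ∪ V → A ∩ (U ∩ V) = ∅ → x ∈ U →
        (A ∩ V).Nonempty → False := by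
      rintro U V hU hV hUV hdis hxU ⟨y, hyA, hyV⟩
      have h1 : A ∩ U ∈ B := by
        refine ⟨hAo.inter hU, inter_subset_left.trans hAF, ?_⟩
        have : F \ (A ∩ U) = (F \ A) ∪ (A ∩ V) := by
          ext z
          constructor
          · rintro ⟨hzF, hz⟩
            by_cases hzA : z ∈ A
            · exact Or.inr ⟨hzA, (hUV hzA).resolve_left fun h => hz ⟨hzA, h⟩⟩
            · exact Or.inl ⟨hzF, hzA⟩
          · rintro (⟨hzF, hz⟩ | ⟨hzA, hzV⟩)
            · exact ⟨hzF, fun h => hz h.1⟩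
            · exact ⟨hAF hzA, fun h => eq_empty_iff_forall_notMem.1 hdis z ⟨hzA, h.2, hzV⟩⟩
        rw [this]
        exact hAB.2.2.union (hAo.inter hV)
      exact eq_empty_iff_forall_notMem.1 hdis y ⟨hyA, (hmin _ h1 ⟨hxA, hxU⟩ hyA).2, hyV⟩
    intro U V hU hV hUV hAU hAV
    by_contra hdis
    rw [not_nonempty_iff_eq_empty] at hdis
    rcases hUV hxA with h | h
    · exact key U V hU hV hUV hdis h hAV
    · exact key V U hV hU (by rwa [union_comm]) (by rwa [inter_comm V U]) h hAU
  have : connectedComponentIn F x = A := by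
    refine Subset.antisymm ?_ (hpre.subset_connectedComponentIn hxA hAF)
    intro y hy
    by_contra hyA
    obtain ⟨z, hz, hz1, hz2⟩ := (isPreconnected_connectedComponentIn (F := F) (x := x)) A (F \ A)
      hAo hAB.2.2 (fun z hz => by
        by_cases hzA : z ∈ A
        · exact Or.inl hzA
        · exact Or.inr ⟨connectedComponentIn_subset F x hz, hzA⟩)
      ⟨x, mem_connectedComponentIn hx, hxA⟩ ⟨y, hy, connectedComponentIn_subset F x hy, hyA⟩
    exact hz2.2 hz1
  rw [this]
  exact hAB

variable {n : ℕ}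

instance FreeBoundary.instT2Space : T2Space (FreeBoundary n) :=
  inferInstanceAs (T2Space {ξ : ℕ → Fin n × Bool // ∀ k, ξ (k + 1) ≠ invLetter (ξ k)})

/-- A subset of the complement of `A` in the boundary which is open and closed in the complement
of `A` and is a union of classes of the line pattern. -/
structure SatClopen (M : Finset (FreeGrp n)) (A U : Set (FreeBoundary n)) : Prop where
  isOpen : IsOpen U
  isOpen_compl : IsOpen (U ∪ A)ᶜ
  disjoint : ∀ ξ ∈ A, ξ ∉ U
  mem_of_lineRel : ∀ ξ η, LineRel M ξ η → ξ ∈ U → η ∈ U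

namespace SatClopen

variable {M : Finset (FreeGrp n)} {A U V H : Set (FreeBoundary n)}

theorem sdiff (hU : SatClopen M A U) (hV : SatClopen M A V) : SatClopen M A (U \ V) where
  isOpen := by
    have : U \ V = U ∩ (V ∪ A)ᶜ := by
      ext ξ
      have := hU.disjoint ξ
      simp only [Set.mem_sdiff, mem_inter_iff, mem_compl_iff, mem_union]
      tauto
    rw [this]
    exact hU.isOpen.inter hV.isOpen_compl
  isOpen_compl := by
    have : (U \ V ∪ A)ᶜ = (U ∪ A)ᶜ ∪ V := by
      ext ξ
      have := hV.disjoint ξ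
      simp only [Set.mem_sdiff, mem_compl_iff, mem_union]
      tauto
    rw [this]
    exact hU.isOpen_compl.union hV.isOpen
  disjoint := fun ξ hξ h => hU.disjoint ξ hξ h.1
  mem_of_lineRel := fun ξ η h hξ =>
    ⟨hU.mem_of_lineRel ξ η h hξ.1, fun hη => hξ.2 (hV.mem_of_lineRel η ξ h.symm hη)⟩

theorem inter (hU : SatClopen M A U) (hA : IsClosed A) (hH : IsClopen H)
    (h : ∀ ξ ∈ U, ∀ η, LineRel M ξ η → ξ ∈ H → η ∈ H) : SatClopen M A (U ∩ H) where
  isOpen := hU.isOpen.inter hH.isOpen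
  isOpen_compl := by
    have : (U ∩ H ∪ A)ᶜ = (U ∪ A)ᶜ ∪ (Hᶜ ∩ Aᶜ) := by
      ext ξ
      simp only [mem_inter_iff, mem_compl_iff, mem_union]
      tauto
    rw [this]
    exact hU.isOpen_compl.union (hH.compl.isOpen.inter hA.isOpen_compl)
  disjoint := fun ξ hξ h => hU.disjoint ξ hξ h.1
  mem_of_lineRel := fun ξ η hr hξ => ⟨hU.mem_of_lineRel ξ η hr hξ.1, h ξ hξ.1 η hr hξ.2⟩

theorem smul (hU : SatClopen M A U) (g : FreeGrp n) : SatClopen M (g • A) (g • U) where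
  isOpen := hU.isOpen.smul g
  isOpen_compl := by
    rw [← smul_set_union, ← smul_set_compl]
    exact hU.isOpen_compl.smul g
  disjoint := fun ξ hξ h => by
    rw [mem_smul_set_iff_inv_smul_mem] at hξ h
    exact hU.disjoint _ hξ h
  mem_of_lineRel := fun ξ η h hξ => by
    rw [mem_smul_set_iff_inv_smul_mem] at hξ ⊢
    exact hU.mem_of_lineRel _ _ (DecompositionSpace.lineRel_smul M g⁻¹ _ _ h) hξ

/-- In a connected decomposition space, there is no bounded nonempty open and closed subset of
the complement of `A`. -/
theorem eq_empty (hconn : ConnectedSpace (DecompositionSpace M)) (hU : SatClopen M A U)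
    (hA : A.Nonempty) {W : Set (FreeBoundary n)} (hW : IsOpen W) (hAW : A ⊆ W)
    (hUW : ∀ ξ ∈ U, ξ ∉ W) : U = ∅ := by
  have hc : IsOpen Uᶜ := by
    have : Uᶜ = (U ∪ A)ᶜ ∪ W := by
      ext ξ
      have h1 := @hAW ξ
      have h2 := hUW ξ
      simp only [mem_compl_iff, mem_union]
      tauto
    rw [this]
    exact hU.isOpen_compl.union hW
  set V : Set (DecompositionSpace M) := {x | Quot.lift (· ∈ U) (fun ξ η h => propext
    ⟨hU.mem_of_lineRel ξ η h, hU.mem_of_lineRel η ξ h.symm⟩) x} with hV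
  have hVU : DecompositionSpace.proj M ⁻¹' V = U := rfl
  have hclopen : IsClopen V := by
    refine ⟨⟨DecompositionSpace.isOpen_preimage_proj.1 ?_⟩,
      DecompositionSpace.isOpen_preimage_proj.1 ?_⟩
    · rw [preimage_compl, hVU]
      exact hc
    · rw [hVU]
      exact hU.isOpen
  rcases isClopen_iff.1 hclopen with h | h
  · rw [← hVU, h, preimage_empty]
  · obtain ⟨ξ, hξ⟩ := hA
    refine absurd ?_ (hU.disjoint ξ hξ)
    rw [← hVU, h]
    trivial

theorem pow_inv_smul_notMem {g : FreeGrp n} (hg : ∀ ξ ∈ H, g • ξ ∈ H) {ξ : FreeBoundary n}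
    (h : ξ ∉ H) (k : ℕ) : (g ^ k)⁻¹ • ξ ∉ H := by
  intro h1
  apply h
  have h2 : ∀ j : ℕ, ∀ ζ ∈ H, g ^ j • ζ ∈ H := fun j ζ hζ => by
    induction j with
    | zero => simpa using hζ
    | succ j ih => rw [pow_succ', mul_smul]; exact hg _ ih
  simpa using h2 k _ h1

/-- An open and closed subset of the complement of the endpoints of an axis accumulates at both
endpoints. -/
theorem eq_empty_of_subset (hconn : ConnectedSpace (DecompositionSpace M))
    (hM : ∀ w ∈ M, w ≠ 1) {g : FreeGrp n} {p q : FreeBoundary n}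
    (h : NorthSouth g p q H) (hU : SatClopen M {p, q} U) (hUH : U ⊆ H) : U = ∅ := by
  by_contra hne
  obtain ⟨ξ, hξ⟩ := nonempty_iff_ne_empty.2 hne
  obtain ⟨j, hj⟩ : ∃ j : ℕ, g⁻¹ ^ j • ξ ∉ H := by
    by_contra! h1
    exact hU.disjoint p (by simp) (h.attract ξ h1 ▸ hξ)
  rw [inv_pow] at hj
  have hpq : ∀ k : ℕ, (g ^ k)⁻¹ • ({p, q} : Set (FreeBoundary n)) = {p, q} := fun k => by
    rw [inv_smul_eq_iff]
    induction k with
    | zero => simp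
    | succ k ih =>
      rw [pow_succ, mul_smul, smul_set_insert, smul_set_singleton, h.smul_left, h.smul_right]
      exact ih
  have hq : ∀ k : ℕ, g ^ k • q = q := fun k => by
    induction k with
    | zero => simp
    | succ k ih => rw [pow_succ, mul_smul, h.smul_right, ih]
  set L := {ξ | ξ ∈ H ∧ ∃ η, η ∉ H ∧ LineRel M ξ η} with hL
  have hLfin : L.Finite := finite_setOf_crossing hM h.isClopen
  set T : ℕ → Set (FreeBoundary n) := fun t => (g ^ (j * (t + 1)))⁻¹ • U with hT
  have hTsat : ∀ t, SatClopen M {p, q} (T t) := fun t => by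
    have := hU.smul (g ^ (j * (t + 1)))⁻¹
    rwa [hpq] at this
  -- The translates `T t` of `U` spread towards `q`, but their traces on the finite set `L` must
  -- repeat.
  obtain ⟨s, t, hst, hTst⟩ : ∃ s t, s < t ∧ T s ∩ L = T t ∩ L := by
    have hfin : (range fun t => T t ∩ L).Finite :=
      hLfin.finite_subsets.subset (by rintro _ ⟨t, rfl⟩; exact inter_subset_right)
    have := hfin.to_subtype
    obtain ⟨s, t, hst, he⟩ := Finite.exists_ne_map_eq_of_infinite
      fun t : ℕ => (⟨T t ∩ L, t, rfl⟩ : range fun t => T t ∩ L)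
    have he' : T s ∩ L = T t ∩ L := congrArg Subtype.val he
    rcases lt_or_gt_of_ne hst with h1 | h1
    exacts [⟨s, t, h1, he'⟩, ⟨t, s, h1, he'.symm⟩]
  -- Equal traces mean that no line from the difference crosses `H`, so its part outside `H` is
  -- still saturated and clopen. That part stays away from both `p` and `q`, hence is empty by
  -- connectedness. Yet it contains the translate of `ξ` by the inverse of `g ^ (j * (t + 1))`,
  -- since backward translates of `ξ` by `j` or more steps are outside `H`.
  have hW := (hTsat t).sdiff (hTsat s)
  have hWH : SatClopen M {p, q} ((T t \ T s) ∩ Hᶜ) := by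
    refine hW.inter (toFinite _).isClosed h.isClopen.compl fun ζ hζ η hr hζH hη => ?_
    have h1 := hW.mem_of_lineRel ζ η hr hζ
    have h2 : η ∈ T t ∩ L := ⟨h1.1, hη, ζ, hζH, hr.symm⟩
    rw [← hTst] at h2
    exact h1.2 h2.1
  have hempty := hWH.eq_empty hconn (insert_nonempty _ _)
    (W := H ∪ (g ^ (j * (t + 1)))⁻¹ • Hᶜ)
    (h.isClopen.isOpen.union (h.isClopen.compl.isOpen.smul _)) (by
      rintro ζ (rfl | rfl)
      · exact Or.inl h.mem
      · right
        rw [mem_smul_set_iff_inv_smul_mem, inv_inv, hq]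
        exact h.notMem) (by
      rintro ζ ⟨⟨hζ1, -⟩, hζ2⟩ (h1 | h1)
      · exact hζ2 h1
      · rw [mem_smul_set_iff_inv_smul_mem] at hζ1 h1
        exact h1 (hUH hζ1))
  refine eq_empty_iff_forall_notMem.1 hempty ((g ^ (j * (t + 1)))⁻¹ • ξ)
    ⟨⟨smul_mem_smul_set hξ, fun h1 => ?_⟩, ?_⟩
  · rw [mem_smul_set_iff_inv_smul_mem] at h1
    have h2 := hUH h1
    obtain ⟨d, rfl⟩ : ∃ d, t = s + 1 + d := ⟨t - (s + 1), by omega⟩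
    rw [show j * (s + 1 + d + 1) = j + j * d + j * (s + 1) by ring, pow_add, pow_add] at h2
    simp only [mul_inv_rev, mul_smul, inv_inv, smul_inv_smul] at h2
    exact pow_inv_smul_notMem h.smul_mem hj (j * d) h2
  · rw [show j * (t + 1) = j + j * t by ring, pow_add, mul_inv_rev, mul_smul]
    exact pow_inv_smul_notMem h.smul_mem hj (j * t)

/-- If the traces agree, no line crosses `H` inside the difference, which therefore splits into a
saturated clopen part in `H` and one in its complement. Each misses a neighbourhood of one end, so
both vanish by `eq_empty_of_subset`, applied to `g` and to its inverse. -/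
theorem eq_of_inter_eq (hconn : ConnectedSpace (DecompositionSpace M))
    (hM : ∀ w ∈ M, w ≠ 1) {g : FreeGrp n} {p q : FreeBoundary n}
    (h : NorthSouth g p q H) (hU : SatClopen M {p, q} U) (hV : SatClopen M {p, q} V)
    (hUV : U ∩ {ξ | ξ ∈ H ∧ ∃ η, η ∉ H ∧ LineRel M ξ η} =
      V ∩ {ξ | ξ ∈ H ∧ ∃ η, η ∉ H ∧ LineRel M ξ η}) : U = V := by
  have key : ∀ {U V : Set (FreeBoundary n)}, SatClopen M {p, q} U → SatClopen M {p, q} V →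
      U ∩ {ξ | ξ ∈ H ∧ ∃ η, η ∉ H ∧ LineRel M ξ η} =
      V ∩ {ξ | ξ ∈ H ∧ ∃ η, η ∉ H ∧ LineRel M ξ η} → U ⊆ V := by
    intro U V hU hV hUV
    have hW := hU.sdiff hV
    have hA : IsClosed ({p, q} : Set (FreeBoundary n)) := (toFinite _).isClosed
    have htr : ∀ ξ ∈ U \ V, ∀ η, LineRel M ξ η → ξ ∈ H → η ∈ H := by
      intro ξ hξ η hr hξH
      by_contra hη
      have h1 := hUV.subset ⟨hξ.1, hξH, η, hη, hr⟩
      exact hξ.2 h1.1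
    have h1 : (U \ V) ∩ H = ∅ := (hW.inter hA h.isClopen htr).eq_empty_of_subset hconn hM h
      inter_subset_right
    have h2 : (U \ V) ∩ Hᶜ = ∅ := by
      have h3 := hW.inter hA h.isClopen.compl fun ξ hξ η hr hξH hη =>
        hξH (htr η (hW.mem_of_lineRel ξ η hr hξ) ξ hr.symm hη)
      rw [pair_comm] at h3
      exact h3.eq_empty_of_subset hconn hM h.inv inter_subset_right
    rw [← sdiff_eq_empty, ← inter_univ (U \ V), ← union_compl_self H, inter_union_distrib_left, h1,
      h2, union_empty]
  exact Subset.antisymm (key hU hV hUV) (key hV hU hUV.symm)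

theorem finite (hconn : ConnectedSpace (DecompositionSpace M)) (hM : ∀ w ∈ M, w ≠ 1)
    {g : FreeGrp n} (hg : g ≠ 1) : {U | SatClopen M (axisEnds g) U}.Finite := by
  obtain ⟨p, q, H, h⟩ := exists_northSouth hg
  rw [h.axisEnds_eq hg]
  refine Finite.of_injOn (t := 𝒫 {ξ | ξ ∈ H ∧ ∃ η, η ∉ H ∧ LineRel M ξ η})
    (f := fun U => U ∩ {ξ | ξ ∈ H ∧ ∃ η, η ∉ H ∧ LineRel M ξ η}) (fun U _ => inter_subset_right)
    (fun U hU V hV hUV => eq_of_inter_eq hconn hM h hU hV hUV) ?_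
  exact (finite_setOf_crossing hM h.isClopen).finite_subsets

end SatClopen

namespace DecompositionSpace

variable {M : Finset (FreeGrp n)} {g : FreeGrp n}

theorem satClopen_preimage_proj (hM : ∀ w ∈ M, w ≠ 1) (hg : g ≠ 1)
    {U : Set (DecompositionSpace M)} (hU : IsOpen U) (hUS : U ⊆ (proj M '' axisEnds g)ᶜ)
    (hU' : IsOpen ((proj M '' axisEnds g)ᶜ \ U)) :
    SatClopen M (axisEnds g) (proj M ⁻¹' U) where
  isOpen := isOpen_preimage_proj.2 hU
  isOpen_compl := by
    have h := isOpen_preimage_proj.2 hU'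
    rwa [preimage_sdiff, preimage_compl, preimage_proj_image_axisEnds hM hg, sdiff_eq,
      ← compl_union, union_comm] at h
  disjoint := fun ξ hξ h => hUS h (mem_image_of_mem _ hξ)
  mem_of_lineRel := fun ξ η h hξ => by
    have : proj M ξ = proj M η := Quot.sound h
    rwa [mem_preimage, ← this]

theorem finite_relClopen (hconn : ConnectedSpace (DecompositionSpace M)) (hM : ∀ w ∈ M, w ≠ 1)
    (hg : g ≠ 1) : {U : Set (DecompositionSpace M) | IsOpen U ∧ U ⊆ (proj M '' axisEnds g)ᶜ ∧
      IsOpen ((proj M '' axisEnds g)ᶜ \ U)}.Finite := by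
  refine Finite.of_injOn (f := fun U => proj M ⁻¹' U) (fun U hU => ?_)
    (fun U _ V _ h => (proj_surjective M).preimage_injective h) (SatClopen.finite hconn hM hg)
  exact satClopen_preimage_proj hM hg hU.1 hU.2.1 hU.2.2

theorem isOpen_compl_image_axisEnds (hM : ∀ w ∈ M, w ≠ 1) (hg : g ≠ 1) :
    IsOpen (proj M '' axisEnds g)ᶜ := by
  rw [← isOpen_preimage_proj, preimage_compl, preimage_proj_image_axisEnds hM hg]
  exact (finite_axisEnds hg).isClosed.isOpen_compl

theorem isOpen_connectedComponentIn (hconn : ConnectedSpace (DecompositionSpace M))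
    (hM : ∀ w ∈ M, w ≠ 1) (hg : g ≠ 1) (x : DecompositionSpace M) :
    IsOpen (connectedComponentIn (proj M '' axisEnds g)ᶜ x) := by
  by_cases hx : x ∈ (proj M '' axisEnds g)ᶜ
  · exact (exists_relClopen_eq_connectedComponentIn (finite_relClopen hconn hM hg)
      (isOpen_compl_image_axisEnds hM hg) hx).1
  · rw [connectedComponentIn_eq_empty hx]
    exact isOpen_empty

theorem finite_connectedComponentIn (hconn : ConnectedSpace (DecompositionSpace M))
    (hM : ∀ w ∈ M, w ≠ 1) (hg : g ≠ 1) :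
    (connectedComponentIn (proj M '' axisEnds g)ᶜ '' (proj M '' axisEnds g)ᶜ).Finite := by
  refine (finite_relClopen hconn hM hg).subset ?_
  rintro _ ⟨x, hx, rfl⟩
  exact exists_relClopen_eq_connectedComponentIn (finite_relClopen hconn hM hg)
    (isOpen_compl_image_axisEnds hM hg) hx

end DecompositionSpace

end

/-! ### Finitely many translates separate two pairs of ends -/

section

open FreeBoundary

variable {n : ℕ}

theorem smul_connectedComponentIn {G X : Type*} [Group G] [MulAction G X] [TopologicalSpace X]
    [ContinuousConstSMul G X] (h : G) (F : Set X) (x : X) :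
    h • connectedComponentIn F x = connectedComponentIn (h • F) (h • x) := by
  by_cases hx : x ∈ F
  · exact (Homeomorph.smul h).image_connectedComponentIn hx
  · rw [connectedComponentIn_eq_empty hx, connectedComponentIn_eq_empty
      (by rwa [smul_mem_smul_set_iff]), smul_set_empty]

/-- A word following the ray to a fixed end far enough can be shifted back along it by `g` or its
inverse, which shortens it by at least the translation length `l`. -/
theorem exists_norm_zpow_mul_lt {g : FreeGrp n} (hg : g ≠ 1) {ξ : FreeBoundary n}
    (hξ : g • ξ = ξ) :
    ∃ N, ∀ f : FreeGrp n, word ξ N <+: f.toWord → ∃ k : ℤ, (g ^ k * f).norm < f.norm := by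
  obtain ⟨d, l, hl, h⟩ := exists_translation hg hξ
  refine ⟨d + l, ?_⟩
  rintro f ⟨t, ht⟩
  have hf : f = vertex ξ (d + l) * FreeGroup.mk t := by
    rw [vertex, FreeGroup.mul_mk, ht, FreeGroup.mk_toWord]
  have key : ∀ x : FreeGrp n, x⁻¹ * vertex ξ d = vertex ξ (d + l) → (x * f).norm < f.norm := by
    intro x hx
    rw [inv_mul_eq_iff_eq_mul] at hx
    rw [hf, ← mul_assoc, ← hx, ← hf]
    have h1 : f.norm = d + l + t.length := by
      rw [FreeGroup.norm, ← ht, List.length_append, word_length]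
    have h2 := FreeGroup.norm_mul_le (vertex ξ d) (FreeGroup.mk t)
    have h3 : (FreeGroup.mk t : FreeGrp n).norm ≤ t.length := FreeGroup.norm_mk_le
    have h4 : (vertex ξ d).norm = d := by rw [FreeGroup.norm, toWord_vertex, word_length]
    omega
  rcases h with h | h
  · exact ⟨-1, by rw [zpow_neg_one]; exact key _ (by rw [inv_inv]; exact h d le_rfl)⟩
  · exact ⟨1, by rw [zpow_one]; exact key _ (h d le_rfl)⟩

namespace DecompositionSpace

variable {M : Finset (FreeGrp n)} {g : FreeGrp n}

theorem zpow_smul_image_axisEnds (hg : g ≠ 1) (k : ℤ) :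
    g ^ k • (proj M '' axisEnds g) = proj M '' axisEnds g := by
  rw [smul_image_proj, (smul_axisEnds_eq_iff hg _).2 ((Commute.refl g).zpow_left k)]

/-- Cylinders of large depth around a vertex which is nearest to the identity among its translates
by the powers of `g` lie in a component of the complement of the axis of `g`. -/
theorem exists_depth_connectedComponentIn (hconn : ConnectedSpace (DecompositionSpace M))
    (hM : ∀ w ∈ M, w ≠ 1) (hg : g ≠ 1) :
    ∃ N, ∀ f : FreeGrp n, (∀ k : ℤ, f.norm ≤ (g ^ k * f).norm) → ∀ ξ η : FreeBoundary n,
      word ξ N = f.toWord.take N → word η N = f.toWord.take N →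
      connectedComponentIn (proj M '' axisEnds g)ᶜ (proj M ξ) =
        connectedComponentIn (proj M '' axisEnds g)ᶜ (proj M η) := by
  obtain ⟨p, q, H, h⟩ := exists_northSouth hg
  obtain ⟨Np, hNp⟩ := exists_norm_zpow_mul_lt hg h.smul_left
  obtain ⟨Nq, hNq⟩ := exists_norm_zpow_mul_lt hg h.smul_right
  -- Minimality of `f` keeps its cylinder away from both ends of the axis, so only this compact set
  -- matters; the open components cover it.
  set K : Set (FreeBoundary n) := {ξ | word ξ Np = word p Np}ᶜ ∩ {ξ | word ξ Nq = word q Nq}ᶜ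
  have hK : IsCompact K :=
    ((isOpen_setOf_word _ _).isClosed_compl.inter (isOpen_setOf_word _ _).isClosed_compl).isCompact
  obtain ⟨N, hN⟩ := exists_depth hK
    (C := range fun x => proj M ⁻¹' connectedComponentIn (proj M '' axisEnds g)ᶜ x)
    (by
      rintro _ ⟨x, rfl⟩
      exact (isOpen_connectedComponentIn hconn hM hg x).preimage (continuous_proj M))
    (by
      intro ξ hξ
      refine ⟨_, ⟨proj M ξ, rfl⟩, mem_connectedComponentIn ?_⟩
      intro hmem
      have h1 : ξ ∈ proj M ⁻¹' (proj M '' axisEnds g) := hmem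
      rw [preimage_proj_image_axisEnds hM hg, h.axisEnds_eq hg] at h1
      rcases h1 with rfl | rfl
      exacts [hξ.1 rfl, hξ.2 rfl])
  refine ⟨max N (max Np Nq), fun f hf ξ η hξ hη => ?_⟩
  have hpre : ∀ m ≤ max N (max Np Nq), word ξ m <+: f.toWord := fun m hm => by
    rw [← take_word ξ hm, hξ]
    exact (List.take_prefix _ _).trans (List.take_prefix _ _)
  have hξK : ξ ∈ K := by
    constructor
    · intro h1
      obtain ⟨k, hk⟩ := hNp f ((show word ξ Np = word p Np from h1) ▸ hpre Np (by simp))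
      exact (hf k).not_gt hk
    · intro h1
      obtain ⟨k, hk⟩ := hNq f ((show word ξ Nq = word q Nq from h1) ▸ hpre Nq (by simp))
      exact (hf k).not_gt hk
  obtain ⟨_, ⟨x, rfl⟩, hx⟩ := hN ξ hξK
  have h1 : proj M ξ ∈ connectedComponentIn (proj M '' axisEnds g)ᶜ x := hx rfl
  have h2 : proj M η ∈ connectedComponentIn (proj M '' axisEnds g)ᶜ x := hx (by
    change word η N = word ξ N
    rw [← take_word η (le_max_left N _), ← take_word ξ (le_max_left N _), hξ, hη])
  rw [← connectedComponentIn_eq h1, ← connectedComponentIn_eq h2]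

/-- At most one of `s` and `t` agrees with the inverse of `f` for `e` letters; on the other, fewer
than `e` letters cancel. -/
theorem exists_word_smul_eq_take {s t : FreeBoundary n} {e : ℕ} (hst : word s e ≠ word t e)
    {f : FreeGrp n} {N : ℕ} (hf : N + e ≤ f.norm) :
    ∃ ξ ∈ ({s, t} : Set (FreeBoundary n)), word (f • ξ) N = f.toWord.take N := by
  have key : ∀ ξ : FreeBoundary n, word ξ e ≠ (FreeGroup.invRev f.toWord).take e →
      word (f • ξ) N = f.toWord.take N := fun ξ hξ => by
    have := word_mk_smul_eq_take FreeGroup.isReduced_toWord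
      (show e ≤ f.toWord.length from (Nat.le_add_left _ _).trans hf) hξ
      (show N + e ≤ f.toWord.length + 1 from hf.trans (Nat.le_succ _))
    rwa [FreeGroup.mk_toWord] at this
  by_cases hs : word s e = (FreeGroup.invRev f.toWord).take e
  · exact ⟨t, by simp, key t fun ht => hst (hs.trans ht.symm)⟩
  · exact ⟨s, by simp, key s hs⟩

/-- Only finitely many translates of a pair of endpoints of an axis separate two given pairs of
distinct boundary points. -/
theorem finite_separating (hconn : ConnectedSpace (DecompositionSpace M))
    (hM : ∀ w ∈ M, w ≠ 1) (hg : g ≠ 1) {s s' t t' : FreeBoundary n} (hs : s ≠ s') (ht : t ≠ t') :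
    {R : Set (DecompositionSpace M) | (∃ f : FreeGrp n, R = f • (proj M '' axisEnds g)) ∧
      connectedComponentIn Rᶜ (proj M s) = connectedComponentIn Rᶜ (proj M s') ∧
      connectedComponentIn Rᶜ (proj M t) = connectedComponentIn Rᶜ (proj M t') ∧
      connectedComponentIn Rᶜ (proj M s) ≠ connectedComponentIn Rᶜ (proj M t)}.Finite := by
  obtain ⟨N, hN⟩ := exists_depth_connectedComponentIn hconn hM hg
  obtain ⟨e₁, he₁⟩ : ∃ e, word s e ≠ word s' e := by
    by_contra! h; exact hs (ext_word h)
  obtain ⟨e₂, he₂⟩ : ∃ e, word t e ≠ word t' e := by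
    by_contra! h; exact ht (ext_word h)
  refine ((finite_setOf_norm_le (N + max e₁ e₂)).image
    fun f : FreeGrp n => f⁻¹ • (proj M '' axisEnds g)).subset ?_
  rintro R ⟨⟨f₀, hR⟩, h1, h2, h3⟩
  -- All elements of this coset carry `R` to the pair of `g`; the shortest one satisfies the
  -- hypothesis of `exists_depth_connectedComponentIn`.
  set k := Function.argmin fun k : ℤ => (g ^ k * f₀⁻¹).norm
  set f := g ^ k * f₀⁻¹ with hf
  have hmin : ∀ j : ℤ, f.norm ≤ (g ^ j * f).norm := fun j => by
    rw [hf, ← mul_assoc, ← zpow_add]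
    exact Function.argmin_le (fun k : ℤ => (g ^ k * f₀⁻¹).norm) (j + k)
  have hfR : f • R = proj M '' axisEnds g := by
    rw [hR, hf, mul_smul, inv_smul_smul, zpow_smul_image_axisEnds hg]
  have hRf : R = f⁻¹ • (proj M '' axisEnds g) := by rw [← hfR, inv_smul_smul]
  refine ⟨f, ?_, hRf.symm⟩
  -- A long `f` sends one of `s`, `s'` and one of `t`, `t'` into the same cylinder, hence into the
  -- same component, although `R` separates the two pairs.
  by_contra hlong
  have hlong' : N + max e₁ e₂ < f.norm := not_le.1 hlong
  obtain ⟨ξ, hξ, hξ'⟩ := exists_word_smul_eq_take he₁ (f := f) (N := N)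
    (by have := le_max_left e₁ e₂; omega)
  obtain ⟨η, hη, hη'⟩ := exists_word_smul_eq_take he₂ (f := f) (N := N)
    (by have := le_max_right e₁ e₂; omega)
  have h4 := hN f hmin _ _ hξ' hη'
  rw [← smul_proj, ← smul_proj, ← hfR, ← smul_set_compl, ← smul_connectedComponentIn,
    ← smul_connectedComponentIn, smul_left_cancel_iff] at h4
  have h5 : connectedComponentIn Rᶜ (proj M ξ) = connectedComponentIn Rᶜ (proj M s) := by
    rcases hξ with rfl | rfl
    exacts [rfl, h1.symm]
  have h6 : connectedComponentIn Rᶜ (proj M η) = connectedComponentIn Rᶜ (proj M t) := by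
    rcases hη with rfl | rfl
    exacts [rfl, h2.symm]
  exact h3 (h5.symm.trans (h4.trans h6))

end DecompositionSpace

end

/-! ### The tree dual to a system of walls -/

section

/-- A walk from `v` avoiding the edge can never leave `A`, so it cannot reach `u`. -/
theorem SimpleGraph.isBridge_of_forall_adj {V : Type*} {G : SimpleGraph V} {u v : V} (A : Set V)
    (hu : u ∉ A) (hv : v ∈ A) (h : ∀ x y, G.Adj x y → s(x, y) ≠ s(u, v) → (x ∈ A → y ∈ A)) :
    G.IsBridge s(u, v) := by
  rw [SimpleGraph.isBridge_iff]
  rintro hr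
  obtain ⟨p⟩ := hr.symm
  have key : ∀ {x y : V}, (G.deleteEdges {s(u, v)}).Walk x y → x ∈ A → y ∈ A := by
    intro x y p
    induction p with
    | nil => exact id
    | cons hadj _ ih =>
      intro hx
      rw [SimpleGraph.deleteEdges_adj] at hadj
      exact ih (h _ _ hadj.1 hadj.2 hx)
  exact hu (key p hv)

/-- A system of mutually non crossing walls `P`, each with a set of sides in `Q`: the side
`side S T` of `S` contains `T`. -/
structure SideSystem (G P Q : Type) [Group G] [MulAction G P] [MulAction G Q] where
  side : P → P → Q
  sides : P → Set Q
  side_mem : ∀ S T, T ≠ S → side S T ∈ sides S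
  smul_side : ∀ (h : G) S T, h • side S T = side (h • S) (h • T)
  smul_mem_sides : ∀ (h : G) S, ∀ C ∈ sides S, h • C ∈ sides (h • S)
  side_symm : ∀ R S T, S ≠ R → T ≠ R → side R S ≠ side R T → side S R = side S T
  finite_sep : ∀ S T, {R | R ≠ S ∧ R ≠ T ∧ side R S ≠ side R T}.Finite
  finite_sides : ∀ S, (sides S).Finite
  exists_ne_side : ∀ S C, ∃ D ∈ sides S, D ≠ C
  exists_smul : ∀ S, ∀ C ∈ sides S, ∃ h : G, h • S ≠ S ∧ side S (h • S) = C
  finite_orbits : ∃ A : Set P, A.Finite ∧ ∀ S, ∃ a ∈ A, ∃ h : G, S = h • a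
  nonempty : Nonempty P

namespace SideSystem

variable {G P Q : Type} [Group G] [MulAction G P] [MulAction G Q] (W : SideSystem G P Q)

/-- The walls separating `S` from `T`. -/
def sep (S T : P) : Set P := {R | R ≠ S ∧ R ≠ T ∧ W.side R S ≠ W.side R T}

theorem sep_comm (S T : P) : W.sep S T = W.sep T S := by
  ext R
  simp only [sep, mem_ofPred_eq, ne_comm (a := W.side R S)]
  tauto

/-- Betweenness is transitive, by `side_symm`, and `R` itself is lost. This is the decrease behind
the minimality argument for adjacent walls and the induction for connectedness. -/
theorem sep_ssubset {R S T : P} (hR : R ∈ W.sep S T) : W.sep S R ⊂ W.sep S T := by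
  refine ⟨fun X ⟨hXS, hXR, hX⟩ => ⟨hXS, ?_, fun he => ?_⟩, fun h => (h hR).2.1 rfl⟩
  · rintro rfl
    exact hX (W.side_symm R X S hR.2.1.symm hR.1.symm hR.2.2.symm).symm
  · refine hR.2.2 ?_
    rw [← W.side_symm X R S hXR.symm hXS.symm hX.symm]
    by_cases hXT : T = X
    · rw [hXT]
    · exact W.side_symm X R T hXR.symm hXT (he ▸ hX.symm)

/-- An orientation of the walls towards a side `o S` of some wall `S`. -/
structure Star where
  toFun : P → Q
  exists_eq : ∃ S, toFun S ∈ W.sides S ∧ ∀ R ≠ S, toFun R = W.side R S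

variable {W}

namespace Star

@[ext] theorem ext {o o' : W.Star} (h : ∀ R, o.toFun R = o'.toFun R) : o = o' := by
  cases o; cases o'; congr; exact funext h

/-- The wall `S` is adjacent to the star `o`. -/
def Inc (S : P) (o : W.Star) : Prop := ∀ R ≠ S, o.toFun R = W.side R S

theorem exists_inc (o : W.Star) : ∃ S, o.Inc S := o.exists_eq.imp fun _ h => h.2

theorem mem_sides (o : W.Star) (R : P) : o.toFun R ∈ W.sides R := by
  obtain ⟨S, h1, h2⟩ := o.exists_eq
  by_cases h : R = S
  · exact h ▸ h1
  · rw [h2 R h]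
    exact W.side_mem R S (Ne.symm h)

theorem eq_of_inc {o o' : W.Star} {S : P} (h : o.Inc S) (h' : o'.Inc S)
    (he : o.toFun S = o'.toFun S) : o = o' := by
  ext R
  by_cases hR : R = S
  · rw [hR, he]
  · rw [h R hR, h' R hR]

variable (W) in
open Classical in
/-- The star of the side `C` of the wall `S`. -/
noncomputable def ofSide (S : P) (C : Q) (hC : C ∈ W.sides S) : W.Star where
  toFun R := if R = S then C else W.side R S
  exists_eq := ⟨S, by simpa using hC, fun R hR => if_neg hR⟩

theorem ofSide_toFun_self (S : P) (C : Q) (hC : C ∈ W.sides S) :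
    (ofSide W S C hC).toFun S = C := if_pos rfl

theorem inc_ofSide (S : P) (C : Q) (hC : C ∈ W.sides S) : (ofSide W S C hC).Inc S :=
  fun _ hR => if_neg hR

instance : MulAction G W.Star where
  smul h o :=
    { toFun := fun R => h • o.toFun (h⁻¹ • R)
      exists_eq := by
        obtain ⟨S, h1, h2⟩ := o.exists_eq
        refine ⟨h • S, ?_, fun R hR => ?_⟩
        · rw [inv_smul_smul]
          exact W.smul_mem_sides h S _ h1
        · rw [h2 _ fun h3 => hR (inv_smul_eq_iff.1 h3), W.smul_side, smul_inv_smul] }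
  one_smul o := by
    ext R
    change (1 : G) • o.toFun ((1 : G)⁻¹ • R) = o.toFun R
    simp
  mul_smul a b o := by
    ext R
    change (a * b) • o.toFun ((a * b)⁻¹ • R) = a • b • o.toFun (b⁻¹ • a⁻¹ • R)
    simp [mul_smul]

theorem smul_toFun (h : G) (o : W.Star) (R : P) :
    (h • o).toFun R = h • o.toFun (h⁻¹ • R) := rfl

theorem Inc.smul {o : W.Star} {S : P} (hS : o.Inc S) (h : G) : (h • o).Inc (h • S) := by
  intro R hR
  rw [smul_toFun, hS _ fun h3 => hR (inv_smul_eq_iff.1 h3), W.smul_side, smul_inv_smul]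

theorem inc_of_sep_eq_empty {o : W.Star} {S T : P} (hS : o.Inc S)
    (hoS : o.toFun S = W.side S T) (h : W.sep S T = ∅) : o.Inc T := by
  intro R hRT
  by_cases hRS : R = S
  · rw [hRS, hoS]
  · rw [hS R hRS]
    by_contra hne
    exact eq_empty_iff_forall_notMem.1 h R ⟨hRS, hRT, hne⟩

/-- Every star has at least two adjacent walls. -/
theorem exists_two_inc (o : W.Star) : ∃ S T, S ≠ T ∧ o.Inc S ∧ o.Inc T := by
  obtain ⟨S, hS⟩ := o.exists_inc
  have hne : {T | T ≠ S ∧ W.side S T = o.toFun S}.Nonempty := by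
    obtain ⟨h, h1, h2⟩ := W.exists_smul S _ (o.mem_sides S)
    exact ⟨h • S, h1, h2⟩
  -- Among the walls on the side chosen by `o`, one nearest to `S`: a wall in between would be on
  -- the same side and nearer.
  set T := Function.argminOn (fun T => (W.sep S T).ncard) _ hne
  obtain ⟨hT1, hT2⟩ : T ≠ S ∧ W.side S T = o.toFun S := Function.argminOn_mem _ _ hne
  refine ⟨S, T, hT1.symm, hS, inc_of_sep_eq_empty hS hT2.symm ?_⟩
  by_contra hsep
  obtain ⟨R, hR⟩ := nonempty_iff_ne_empty.2 hsep
  have h1 : R ∈ {T | T ≠ S ∧ W.side S T = o.toFun S} :=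
    ⟨hR.1, (W.side_symm R S T hR.1.symm hR.2.1.symm hR.2.2).trans hT2⟩
  exact (Function.argminOn_le (fun T => (W.sep S T).ncard) _ h1).not_gt
    (ncard_lt_ncard (W.sep_ssubset hR) (W.finite_sep S T))

/-- A consistent orientation of the walls with finitely many walls between it and each wall is a
star. -/
theorem exists_toFun_eq (o : P → Q) (ho : ∀ R, o R ∈ W.sides R)
    (hsymm : ∀ R S, R ≠ S → W.side R S ≠ o R → W.side S R = o S)
    (hfin : ∀ S, {R | R ≠ S ∧ W.side R S ≠ o R}.Finite) : ∃ x : W.Star, x.toFun = o := by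
  have := W.nonempty
  -- This minimizes the number of walls oriented away from `S`. If some `R` were, then passing from
  -- `S` to `R` would strictly lower the count, by consistency.
  set S := Function.argmin fun S => {R | R ≠ S ∧ W.side R S ≠ o R}.ncard
  refine ⟨⟨o, S, ho S, fun R hRS => ?_⟩, rfl⟩
  by_contra hR
  refine (Function.argmin_le (fun S => {R | R ≠ S ∧ W.side R S ≠ o R}.ncard) R).not_gt
    (ncard_lt_ncard ?_ (hfin S))
  have hSR := hsymm R S hRS (Ne.symm hR)
  refine ⟨fun X ⟨hXR, hX⟩ => ⟨?_, fun he => ?_⟩, fun h => (h ⟨hRS, Ne.symm hR⟩).1 rfl⟩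
  · rintro rfl
    exact hX hSR
  · refine hR ?_
    rw [← hsymm X R hXR hX]
    by_cases hXS : S = X
    · rw [hXS]
    · exact W.side_symm X R S hXR.symm hXS fun h => hX (h.trans he)

/-- A power of an element stabilizing a wall stabilizes an adjacent star. -/
theorem exists_pow_smul_eq {o : W.Star} {S : P} (hS : o.Inc S) {z : G} (hz : z • S = S) :
    ∃ k : ℕ, k ≠ 0 ∧ z ^ k • o = o := by
  have hzk : ∀ k : ℕ, z ^ k • S = S := fun k => by
    induction k with
    | zero => simp
    | succ k ih => rw [pow_succ, mul_smul, hz, ih]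
  have := (W.finite_sides S).to_subtype
  -- Two powers of `z` send the side `o.toFun S` to the same one of the finitely many sides, and a
  -- star adjacent to `S` is determined by its side there.
  obtain ⟨i, j, hij, h⟩ := Finite.exists_ne_map_eq_of_infinite
    fun k : ℕ => (⟨z ^ k • o.toFun S, by
      have := W.smul_mem_sides (z ^ k) S _ (o.mem_sides S)
      rwa [hzk] at this⟩ : W.sides S)
  have h' : z ^ i • o.toFun S = z ^ j • o.toFun S := congrArg Subtype.val h
  have key : ∀ {i j : ℕ}, i < j → z ^ i • o.toFun S = z ^ j • o.toFun S →
      ∃ k : ℕ, k ≠ 0 ∧ z ^ k • o = o := by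
    intro i j hlt h
    refine ⟨j - i, by omega, ?_⟩
    have h1 : z ^ (j - i) • o.toFun S = o.toFun S := by
      rw [← Nat.add_sub_of_le hlt.le, pow_add, mul_smul, smul_left_cancel_iff] at h
      exact h.symm
    refine eq_of_inc (S := S) ?_ hS ?_
    · have := hS.smul (z ^ (j - i))
      rwa [hzk] at this
    · rw [smul_toFun, inv_smul_eq_iff.2 (hzk (j - i)).symm, h1]
  rcases lt_or_gt_of_ne hij with h1 | h1
  exacts [key h1 h', key h1 h'.symm]

end Star

variable (W) in
/-- The bipartite graph of walls and stars. -/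
def graph : SimpleGraph (P ⊕ W.Star) where
  Adj u v := ∃ S o, Star.Inc S o ∧ (u = .inl S ∧ v = .inr o ∨ u = .inr o ∧ v = .inl S)
  symm := ⟨fun u v ⟨S, o, h, h'⟩ => ⟨S, o, h, by tauto⟩⟩
  loopless := ⟨fun u => by
    rintro ⟨S, o, -, ⟨rfl, h⟩ | ⟨rfl, h⟩⟩ <;> cases h⟩

theorem graph_adj_inl_inr {S : P} {o : W.Star} (h : o.Inc S) : W.graph.Adj (.inl S) (.inr o) :=
  ⟨S, o, h, Or.inl ⟨rfl, rfl⟩⟩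

/-- A separating wall splits the problem into two with fewer separating walls. If there is none, the
star at `S` pointing to `T` is adjacent to both. -/
theorem reachable_inl (S T : P) : W.graph.Reachable (.inl S) (.inl T) := by
  induction hk : (W.sep S T).ncard using Nat.strong_induction_on generalizing S T with
  | _ k ih =>
    by_cases hST : T = S
    · rw [hST]
    rcases (W.sep S T).eq_empty_or_nonempty with h | ⟨R, hR⟩
    · have hC := W.side_mem S T hST
      have h1 := Star.inc_ofSide S _ hC
      have h2 := Star.inc_of_sep_eq_empty h1 (Star.ofSide_toFun_self S _ hC) h
      exact (graph_adj_inl_inr h1).reachable.trans (graph_adj_inl_inr h2).reachable.symm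
    · have h1 := ncard_lt_ncard (W.sep_ssubset hR) (W.finite_sep S T)
      have h2 := ncard_lt_ncard (W.sep_ssubset (W.sep_comm S T ▸ hR)) (W.finite_sep T S)
      rw [W.sep_comm T S] at h2
      exact (ih _ (hk ▸ h1) S R rfl).trans (ih _ (hk ▸ h2) T R rfl).symm

theorem isTree_graph : W.graph.IsTree := by
  have := W.nonempty
  refine ⟨⟨?_⟩, ?_⟩
  · have key : ∀ u, ∃ S, W.graph.Reachable u (.inl S) := by
      rintro (S | o)
      · exact ⟨S, .refl _⟩
      · obtain ⟨S, hS⟩ := o.exists_inc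
        exact ⟨S, (graph_adj_inl_inr hS).reachable.symm⟩
    intro u v
    obtain ⟨S, hS⟩ := key u
    obtain ⟨T, hT⟩ := key v
    exact hS.trans ((reachable_inl S T).trans hT.symm)
  · have key : ∀ (S : P) (o : W.Star), o.Inc S → W.graph.IsBridge s(.inl S, .inr o) := by
      intro S o hS
      -- This set is the half of the graph beyond the edge: walls on the side `o.toFun S` of `S`,
      -- and stars choosing that side. An adjacent wall and star agree about `S` unless the wall is
      -- `S`; a star in this half adjacent to `S` is `o` itself.
      refine SimpleGraph.isBridge_of_forall_adj
        {x | Sum.elim (fun T => T ≠ S ∧ W.side S T = o.toFun S)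
          (fun o' : W.Star => o'.toFun S = o.toFun S) x} (fun h => h.1 rfl) rfl ?_
      rintro x y ⟨T, o', hT, ⟨rfl, rfl⟩ | ⟨rfl, rfl⟩⟩ hne
      · rintro ⟨h1, h2⟩
        exact (hT S h1.symm).trans h2
      · intro h1
        change o'.toFun S = o.toFun S at h1
        have hTS : T ≠ S := by
          rintro rfl
          refine hne ?_
          rw [Star.eq_of_inc hT hS h1]
          exact Sym2.eq_swap
        exact ⟨hTS, (hT S hTS.symm).symm.trans h1⟩
    rw [SimpleGraph.isAcyclic_iff_forall_adj_isBridge]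
    rintro u v ⟨S, o, h, ⟨rfl, rfl⟩ | ⟨rfl, rfl⟩⟩
    · exact key S o h
    · rw [Sym2.eq_swap]
      exact key S o h

variable (W) in
-- An edge amounts to a wall together with one of its finitely many sides, and the walls form
-- finitely many orbits.
theorem exists_finite_inc : ∃ E : Set (P × W.Star), E.Finite ∧
    ∀ S (o : W.Star), o.Inc S → ∃ e ∈ E, ∃ h : G, S = h • e.1 ∧ o = h • e.2 := by
  obtain ⟨A, hA, hAS⟩ := W.finite_orbits
  refine ⟨{e | e.1 ∈ A ∧ e.2.Inc e.1}, ?_, fun S o hS => ?_⟩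
  · refine Finite.of_injOn (f := fun e => (e.1, e.2.toFun e.1))
      (t := ⋃ S ∈ A, (fun C => (S, C)) '' W.sides S) (fun e he => ?_) ?_
      (hA.biUnion fun S _ => (W.finite_sides S).image _)
    · exact mem_biUnion he.1 ⟨_, e.2.mem_sides _, rfl⟩
    · rintro ⟨S, o⟩ ⟨-, hS⟩ ⟨S', o'⟩ ⟨-, hS'⟩ he
      obtain ⟨rfl, he⟩ := Prod.ext_iff.1 he
      exact Prod.ext rfl (Star.eq_of_inc hS hS' he)
  · obtain ⟨a, ha, h, rfl⟩ := hAS S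
    refine ⟨(a, h⁻¹ • o), ⟨ha, ?_⟩, h, rfl, (smul_inv_smul h o).symm⟩
    have := hS.smul h⁻¹
    rwa [inv_smul_smul] at this

variable (W) in
/-- The splitting given by the action on the tree of walls and stars. -/
def splitting : Splitting G where
  V := P ⊕ W.Star
  tree := W.graph
  isTree := isTree_graph
  adj_smul := by
    rintro h u v ⟨S, o, hS, ⟨rfl, rfl⟩ | ⟨rfl, rfl⟩⟩
    · exact graph_adj_inl_inr (hS.smul h)
    · exact (graph_adj_inl_inr (hS.smul h)).symm
  no_inversion := by
    rintro h u v ⟨S, o, hS, ⟨rfl, rfl⟩ | ⟨rfl, rfl⟩⟩ ⟨h1, -⟩ <;> cases h1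
  finite_vertex_orbits := by
    obtain ⟨E, hE, h⟩ := W.exists_finite_inc
    obtain ⟨A, hA, hAS⟩ := W.finite_orbits
    refine ⟨.inl '' A ∪ (fun e => .inr e.2) '' E, (hA.image _).union (hE.image _), ?_⟩
    rintro (S | o)
    · obtain ⟨a, ha, h, rfl⟩ := hAS S
      exact ⟨_, Or.inl ⟨a, ha, rfl⟩, h, rfl⟩
    · obtain ⟨S, hS⟩ := o.exists_inc
      obtain ⟨e, he, g, -, rfl⟩ := h S o hS
      exact ⟨_, Or.inr ⟨e, he, rfl⟩, g, rfl⟩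
  finite_edge_orbits := by
    obtain ⟨E, hE, h⟩ := W.exists_finite_inc
    refine ⟨(fun e => (.inl e.1, .inr e.2)) '' E ∪ (fun e => (.inr e.2, .inl e.1)) '' E,
      (hE.image _).union (hE.image _), ?_⟩
    rintro u v ⟨S, o, hS, ⟨rfl, rfl⟩ | ⟨rfl, rfl⟩⟩ <;>
      obtain ⟨e, he, g, rfl, rfl⟩ := h S o hS
    · exact ⟨_, Or.inl ⟨e, he, rfl⟩, g, rfl, rfl⟩
    · exact ⟨_, Or.inr ⟨e, he, rfl⟩, g, rfl, rfl⟩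
  no_fixed_vertex := by
    rintro (S | o)
    · obtain ⟨C, hC, -⟩ := W.exists_ne_side S (W.side S S)
      obtain ⟨h, h1, -⟩ := W.exists_smul S C hC
      exact ⟨h, fun h2 => h1 (Sum.inl_injective h2)⟩
    · obtain ⟨S, hS⟩ := o.exists_inc
      obtain ⟨C, hC, hne⟩ := W.exists_ne_side S (o.toFun S)
      obtain ⟨h, h1, h2⟩ := W.exists_smul S C hC
      -- If `h` fixed `o`, then `h • S` would be adjacent to `o`, so at `S` the star would point
      -- towards `h • S`, that is, choose `C`.
      refine ⟨h, fun h3 => hne ?_⟩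
      have h4 : h • o = o := Sum.inr_injective h3
      rw [← h2, ← hS.smul h S h1.symm, h4]

end SideSystem

end

/-! ### Cut pairs in the decomposition space as walls -/

section

open FreeBoundary DecompositionSpace

variable {n : ℕ} {M : Finset (FreeGrp n)}

/-- An invariant family of pairwise non crossing cut sets, each of which is the image of the pair of
endpoints of an axis. -/
structure IsWallFamily (M : Finset (FreeGrp n))
    (F : SubMulAction (FreeGrp n) (Set (DecompositionSpace M))) : Prop where
  two_le : 2 ≤ n
  ne_one : ∀ w ∈ M, w ≠ 1
  connected : ConnectedSpace (DecompositionSpace M)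
  exists_axis : ∀ R ∈ F, ∃ g : FreeGrp n, g ≠ 1 ∧ R = proj M '' axisEnds g
  isCutSet : ∀ R ∈ F, IsCutSet R
  not_crosses : ∀ R ∈ F, ∀ T ∈ F, ¬ Crosses R T
  finite_orbits : ∃ A : Set F, A.Finite ∧ ∀ R : F, ∃ a ∈ A, ∃ h : FreeGrp n, R = h • a
  nonempty : Nonempty F

/-- The union of the components of the complement of `R` that meet `T`. -/
def wallSide {X : Type*} [TopologicalSpace X] (R T : Set X) : Set X :=
  ⋃ x ∈ T, connectedComponentIn Rᶜ x

theorem smul_wallSide {G X : Type*} [Group G] [MulAction G X] [TopologicalSpace X]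
    [ContinuousConstSMul G X] (h : G) (R T : Set X) :
    h • wallSide R T = wallSide (h • R) (h • T) := by
  simp only [wallSide, smul_set_iUnion, smul_connectedComponentIn, smul_set_compl]
  rw [← image_smul (t := T), biUnion_image]

namespace IsWallFamily

variable {F : SubMulAction (FreeGrp n) (Set (DecompositionSpace M))}
  {R S T : Set (DecompositionSpace M)}

theorem nonempty_wall (hF : IsWallFamily M F) (hR : R ∈ F) : R.Nonempty := by
  obtain ⟨g, hg, rfl⟩ := hF.exists_axis R hR
  exact (axisEnds_nonempty hg).image _

theorem notMem_of_mem (hF : IsWallFamily M F) (hR : R ∈ F) (hS : S ∈ F) (hRS : R ≠ S)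
    {x : DecompositionSpace M} (hx : x ∈ R) : x ∉ S := by
  intro hxS
  obtain ⟨f, hf, rfl⟩ := hF.exists_axis R hR
  obtain ⟨g, hg, rfl⟩ := hF.exists_axis S hS
  obtain ⟨ξ, hξ, rfl⟩ := hx
  obtain ⟨η, hη, h⟩ := hxS
  exact hRS (by rw [axisEnds_eq_of_proj_eq hF.ne_one hf hg hξ hη h.symm])

theorem isOpen_component (hF : IsWallFamily M F) (hR : R ∈ F) (x : DecompositionSpace M) :
    IsOpen (connectedComponentIn Rᶜ x) := by
  obtain ⟨g, hg, rfl⟩ := hF.exists_axis R hR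
  exact isOpen_connectedComponentIn hF.connected hF.ne_one hg x

/-- Non-crossing puts all of `T` in one component, so any of its points represents the side. -/
theorem wallSide_eq (hF : IsWallFamily M F) (hR : R ∈ F) (hT : T ∈ F) (hTR : T ≠ R)
    {x : DecompositionSpace M} (hx : x ∈ T) : wallSide R T = connectedComponentIn Rᶜ x := by
  refine Subset.antisymm (iUnion₂_subset fun y hy => ?_) (subset_biUnion_of_mem hx)
  refine (connectedComponentIn_eq ?_).symm.subset
  by_contra h
  exact hF.not_crosses T hT R hR ⟨x, hx, y, hy, hF.notMem_of_mem hT hR hTR hx,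
    hF.notMem_of_mem hT hR hTR hy, h⟩

/-- If `R` separates `S` from a point, then the point lies on the same side of `S` as `R`. -/
theorem wallSide_eq_of_ne (hF : IsWallFamily M F) (hR : R ∈ F) (hS : S ∈ F) (hRS : R ≠ S)
    {x : DecompositionSpace M} (hxR : x ∉ R) (h : wallSide R S ≠ connectedComponentIn Rᶜ x) :
    wallSide S R = connectedComponentIn Sᶜ x := by
  have := hF.connected
  set C := connectedComponentIn Rᶜ x with hC
  have hxC : x ∈ C := mem_connectedComponentIn hxR
  have hCS : C ⊆ Sᶜ := fun y hyC hyS => h (by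
    rw [hF.wallSide_eq hR hS hRS.symm hyS, hC, connectedComponentIn_eq hyC])
  have hpre : IsPreconnected C := isPreconnected_connectedComponentIn
  -- Otherwise `C` would be clopen in the connected decomposition space. Adding `r` to `C` gives a
  -- connected set avoiding `S` that joins `R` to `x`.
  obtain ⟨r, hrC, hrR⟩ : (closure C ∩ R).Nonempty := by
    by_contra hne
    have h1 : closure C ⊆ Rᶜ := fun y hy hyR => hne ⟨y, hy, hyR⟩
    have h2 : closure C ⊆ C :=
      hpre.closure.subset_connectedComponentIn (subset_closure hxC) h1
    have h3 : IsClopen C := ⟨isClosed_of_closure_subset h2, hF.isOpen_component hR x⟩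
    obtain ⟨r, hr⟩ := hF.nonempty_wall hR
    rcases isClopen_iff.1 h3 with h4 | h4
    · exact (h4 ▸ hxC : x ∈ (∅ : Set _))
    · exact connectedComponentIn_subset _ _ (h4 ▸ mem_univ r : r ∈ C) hr
  have h5 : IsPreconnected (insert r C) :=
    hpre.subset_closure (subset_insert _ _) (insert_subset hrC subset_closure)
  have h6 : insert r C ⊆ Sᶜ := insert_subset (hF.notMem_of_mem hR hS hRS hrR) hCS
  rw [hF.wallSide_eq hS hR hRS hrR]
  exact connectedComponentIn_eq
    (h5.subset_connectedComponentIn (mem_insert r C) h6 (mem_insert_of_mem r hxC))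

theorem finite_separating (hF : IsWallFamily M F) {s s' t t' : FreeBoundary n} (hs : s ≠ s')
    (ht : t ≠ t') : {R : F |
      connectedComponentIn (R : Set _)ᶜ (proj M s) = connectedComponentIn (R : Set _)ᶜ (proj M s') ∧
      connectedComponentIn (R : Set _)ᶜ (proj M t) = connectedComponentIn (R : Set _)ᶜ (proj M t') ∧
      connectedComponentIn (R : Set _)ᶜ (proj M s) ≠
        connectedComponentIn (R : Set _)ᶜ (proj M t)}.Finite := by
  obtain ⟨A, hA, hAF⟩ := hF.finite_orbits
  choose g hg1 hg using hF.exists_axis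
  refine Finite.of_injOn (f := Subtype.val) (fun R hR => ?_) Subtype.val_injective.injOn
    (hA.biUnion fun a _ => DecompositionSpace.finite_separating hF.connected hF.ne_one
      (hg1 a a.2) hs ht)
  obtain ⟨a, ha, h, rfl⟩ := hAF R
  refine mem_biUnion ha ⟨⟨h, ?_⟩, hR⟩
  rw [← hg a a.2]
  rfl

theorem exists_smul_subset (hF : IsWallFamily M F) (hR : R ∈ F) {U : Set (DecompositionSpace M)}
    (hU : IsOpen U) (hne : U.Nonempty) : ∃ h : FreeGrp n, h • R ⊆ U := by
  obtain ⟨g, hg, rfl⟩ := hF.exists_axis R hR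
  obtain ⟨h, hh⟩ := exists_smul_axisEnds_subset hF.two_le hg (hU.preimage (continuous_proj M))
    (hne.preimage (proj_surjective M))
  exact ⟨h, by rwa [smul_image_proj, image_subset_iff]⟩

theorem exists_component_ne (hF : IsWallFamily M F) (hR : R ∈ F) (C : Set (DecompositionSpace M)) :
    ∃ x ∈ Rᶜ, connectedComponentIn Rᶜ x ≠ C := by
  by_contra! h
  apply hF.isCutSet R hR
  rcases (Rᶜ).eq_empty_or_nonempty with h1 | ⟨x, hx⟩
  · rw [h1]
    exact isPreconnected_empty
  · have : Rᶜ = connectedComponentIn Rᶜ x := Subset.antisymm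
      (fun y hy => by rw [h x hx, ← h y hy]; exact mem_connectedComponentIn hy)
      (connectedComponentIn_subset _ _)
    rw [this]
    exact isPreconnected_connectedComponentIn

/-- The side system of a family of walls. -/
def sideSystem (hF : IsWallFamily M F) : SideSystem (FreeGrp n) F (Set (DecompositionSpace M)) where
  side R T := wallSide (R : Set (DecompositionSpace M)) T
  sides R := connectedComponentIn (R : Set (DecompositionSpace M))ᶜ '' (R : Set _)ᶜ
  side_mem R T hTR := by
    obtain ⟨x, hx⟩ := hF.nonempty_wall T.2
    have hne : (T : Set (DecompositionSpace M)) ≠ R := fun h => hTR (Subtype.ext h)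
    rw [hF.wallSide_eq R.2 T.2 hne hx]
    exact mem_image_of_mem _ (hF.notMem_of_mem T.2 R.2 hne hx)
  smul_side h R T := smul_wallSide h _ _
  smul_mem_sides := by
    rintro h R _ ⟨x, hx, rfl⟩
    refine ⟨h • x, ?_, ?_⟩
    · rw [SubMulAction.val_smul, ← smul_set_compl, smul_mem_smul_set_iff]
      exact hx
    · rw [smul_connectedComponentIn, smul_set_compl, SubMulAction.val_smul]
  side_symm R S T hSR hTR h := by
    have hne : ∀ {A B : F}, A ≠ B → (A : Set (DecompositionSpace M)) ≠ B :=
      fun h1 h2 => h1 (Subtype.ext h2)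
    by_cases hST : S = T
    · exact absurd (by rw [hST]) h
    obtain ⟨x, hx⟩ := hF.nonempty_wall T.2
    rw [hF.wallSide_eq R.2 T.2 (hne hTR) hx] at h
    rw [hF.wallSide_eq S.2 T.2 (hne (Ne.symm hST)) hx]
    exact hF.wallSide_eq_of_ne R.2 S.2 (hne hSR.symm)
      (hF.notMem_of_mem T.2 R.2 (hne hTR) hx) h
  finite_sep S T := by
    obtain ⟨f, hf, hSf⟩ := hF.exists_axis S S.2
    obtain ⟨g, hg, hTg⟩ := hF.exists_axis T T.2
    obtain ⟨s, s', hs, hf'⟩ := exists_axisEnds_eq_pair hf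
    obtain ⟨t, t', ht, hg'⟩ := exists_axisEnds_eq_pair hg
    have hsS : proj M s ∈ (S : Set _) ∧ proj M s' ∈ (S : Set _) := by
      rw [hSf, hf']; exact ⟨mem_image_of_mem _ (by simp), mem_image_of_mem _ (by simp)⟩
    have htT : proj M t ∈ (T : Set _) ∧ proj M t' ∈ (T : Set _) := by
      rw [hTg, hg']; exact ⟨mem_image_of_mem _ (by simp), mem_image_of_mem _ (by simp)⟩
    refine (hF.finite_separating hs ht).subset fun R ⟨hRS, hRT, h⟩ => ?_
    have hne : ∀ {A B : F}, A ≠ B → (B : Set (DecompositionSpace M)) ≠ A :=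
      fun h1 h2 => h1 (Subtype.ext h2.symm)
    rw [hF.wallSide_eq R.2 S.2 (hne hRS) hsS.1, hF.wallSide_eq R.2 T.2 (hne hRT) htT.1] at h
    refine ⟨?_, ?_, h⟩
    · rw [← hF.wallSide_eq R.2 S.2 (hne hRS) hsS.1, ← hF.wallSide_eq R.2 S.2 (hne hRS) hsS.2]
    · rw [← hF.wallSide_eq R.2 T.2 (hne hRT) htT.1, ← hF.wallSide_eq R.2 T.2 (hne hRT) htT.2]
  finite_sides R := by
    obtain ⟨g, hg, hRg⟩ := hF.exists_axis R R.2
    rw [hRg]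
    exact finite_connectedComponentIn hF.connected hF.ne_one hg
  exists_ne_side R C := by
    obtain ⟨x, hx, h⟩ := hF.exists_component_ne R.2 C
    exact ⟨_, mem_image_of_mem _ hx, h⟩
  exists_smul := by
    rintro R _ ⟨x, hx, rfl⟩
    obtain ⟨h, hh⟩ := hF.exists_smul_subset R.2 (hF.isOpen_component R.2 x)
      ⟨x, mem_connectedComponentIn hx⟩
    obtain ⟨y, hy⟩ := hF.nonempty_wall (F.smul_mem h R.2)
    have hne : h • (R : Set (DecompositionSpace M)) ≠ R := fun h1 =>
      connectedComponentIn_subset _ _ (hh hy) (h1 ▸ hy)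
    refine ⟨h, fun h1 => hne (congrArg Subtype.val h1), ?_⟩
    rw [SubMulAction.val_smul, hF.wallSide_eq R.2 (F.smul_mem h R.2) hne hy,
      connectedComponentIn_eq (hh hy)]
  finite_orbits := hF.finite_orbits
  nonempty := hF.nonempty

/-- Images of different pairs of axis ends are disjoint, so preserving the image amounts to
preserving the pair in the boundary. -/
theorem smul_eq_iff (hF : IsWallFamily M F) {g : FreeGrp n} (hg : g ≠ 1) (h : FreeGrp n) :
    h • (proj M '' axisEnds g) = proj M '' axisEnds g ↔ Commute h g := by
  rw [← smul_axisEnds_eq_iff hg, smul_image_proj]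
  refine ⟨fun heq => ?_, fun heq => by rw [heq]⟩
  obtain ⟨ξ, hξ⟩ := axisEnds_nonempty hg
  have h1 : h • ξ ∈ h • axisEnds g := smul_mem_smul_set hξ
  obtain ⟨η, hη, he⟩ := heq.subset (mem_image_of_mem _ h1)
  rw [smul_axisEnds hg] at h1 ⊢
  exact axisEnds_eq_of_proj_eq hF.ne_one (conj_ne_one hg h) hg h1 hη he.symm

theorem stabilizer_eq (hF : IsWallFamily M F) (R : F) {g : FreeGrp n} (hg : g ≠ 1)
    (hR : (R : Set _) = proj M '' axisEnds g) :
    MulAction.stabilizer (FreeGrp n) R = Subgroup.centralizer {g} := by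
  ext h
  rw [MulAction.mem_stabilizer_iff, Subgroup.mem_centralizer_singleton_iff, Subtype.ext_iff,
    SubMulAction.val_smul, hR, hF.smul_eq_iff hg]
  rfl

/-- Powers of the axis elements of two adjacent walls fix the star. In a cyclic stabilizer these
powers would commute, hence so would the elements, and the two walls would be equal. -/
theorem not_isCyclic_stabilizer (hF : IsWallFamily M F) (o : hF.sideSystem.Star) :
    ¬ IsCyclic (MulAction.stabilizer (FreeGrp n) o) := by
  intro hcyc
  obtain ⟨S, T, hST, hS, hT⟩ := o.exists_two_inc
  obtain ⟨f, hf, hSf⟩ := hF.exists_axis S S.2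
  obtain ⟨g, hg, hTg⟩ := hF.exists_axis T T.2
  have hfS : f • S = S := Subtype.ext (by
    rw [SubMulAction.val_smul, hSf, (hF.smul_eq_iff hf f).2 (Commute.refl f)])
  have hgT : g • T = T := Subtype.ext (by
    rw [SubMulAction.val_smul, hTg, (hF.smul_eq_iff hg g).2 (Commute.refl g)])
  obtain ⟨k, hk, hk'⟩ := SideSystem.Star.exists_pow_smul_eq hS hfS
  obtain ⟨m, hm, hm'⟩ := SideSystem.Star.exists_pow_smul_eq hT hgT
  have h1 := Subgroup.commute_of_isCyclic hcyc (MulAction.mem_stabilizer_iff.2 hk')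
    (MulAction.mem_stabilizer_iff.2 hm')
  have h2 : Commute f g := commute_of_commute_pow hm (commute_of_commute_pow hk h1.symm).symm
  exact hST (Subtype.ext (by rw [hSf, hTg, axisEnds_eq_of_commute hf hg h2]))

/-- Every element generating a line of the pattern fixes a wall or a star. -/
theorem exists_smul_eq (hF : IsWallFamily M F) {w : FreeGrp n} (hw : w ∈ M) :
    (∃ R : F, w • R = R) ∨ ∃ o : hF.sideSystem.Star, w • o = o := by
  have hw1 := hF.ne_one w hw
  obtain ⟨p, q, hpq, hax⟩ := exists_axisEnds_eq_pair hw1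
  have hp : p ∈ axisEnds w := by simp [hax]
  have hq : q ∈ axisEnds w := by simp [hax]
  have hproj : proj M p = proj M q :=
    (proj_eq_iff hF.ne_one).2 (Or.inr ⟨w, hw, 1, by simpa using hp, by simpa using hq⟩)
  by_cases hmem : ∃ R : F, proj M p ∈ (R : Set (DecompositionSpace M))
  · left
    obtain ⟨R, hR⟩ := hmem
    obtain ⟨g, hg, hRg⟩ := hF.exists_axis R R.2
    rw [hRg] at hR
    obtain ⟨η, hη, h⟩ := hR
    have h1 := axisEnds_eq_of_proj_eq hF.ne_one hg hw1 hη hp h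
    refine ⟨R, Subtype.ext ?_⟩
    rw [SubMulAction.val_smul, hRg, h1, (hF.smul_eq_iff hw1 w).2 (Commute.refl w)]
  · right
    push Not at hmem
    have hne : ∀ {A B : F}, A ≠ B → (A : Set (DecompositionSpace M)) ≠ B :=
      fun h1 h2 => h1 (Subtype.ext h2)
    -- The common image of `p` and `q` lies on no wall, so its components orient all walls. Those
    -- oriented away from `S` separate the ends defining `S` from `p` and `q`, hence are finite in
    -- number. The orientation is fixed by `w` because `p` is.
    obtain ⟨o, ho⟩ := SideSystem.Star.exists_toFun_eq (W := hF.sideSystem)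
      (fun R => connectedComponentIn (R : Set (DecompositionSpace M))ᶜ (proj M p))
      (fun R => mem_image_of_mem _ (hmem R))
      (fun R S hRS h => hF.wallSide_eq_of_ne R.2 S.2 (hne hRS) (hmem R) h)
      (fun S => by
        obtain ⟨f, hf, hSf⟩ := hF.exists_axis S S.2
        obtain ⟨s, s', hs, hf'⟩ := exists_axisEnds_eq_pair hf
        have hsS : proj M s ∈ (S : Set _) ∧ proj M s' ∈ (S : Set _) := by
          rw [hSf, hf']; exact ⟨mem_image_of_mem _ (by simp), mem_image_of_mem _ (by simp)⟩
        refine (hF.finite_separating hs hpq).subset fun R ⟨hRS, h⟩ => ?_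
        have hSR := hne (Ne.symm hRS)
        refine ⟨?_, by rw [hproj], ?_⟩
        · rw [← hF.wallSide_eq R.2 S.2 hSR hsS.1, ← hF.wallSide_eq R.2 S.2 hSR hsS.2]
        · rw [← hF.wallSide_eq R.2 S.2 hSR hsS.1]
          exact h)
    refine ⟨o, SideSystem.Star.ext fun R => ?_⟩
    rw [SideSystem.Star.smul_toFun, ho, smul_connectedComponentIn, smul_set_compl,
      SubMulAction.val_smul, smul_inv_smul, smul_proj, (mem_axisEnds_iff hw1).1 hp]

end IsWallFamily

end

/-! ### The splitting -/

theorem mainTheorem7 (n : ℕ) (hn : 2 ≤ n)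
    (M : Finset (FreeGrp n)) (hM : ∀ w ∈ M, w ≠ 1)
    (hconn : ConnectedSpace (DecompositionSpace M))
    {I : Type*} [Nonempty I] (S : I → Set (DecompositionSpace M)) (g : I → FreeGrp n)
    (hcut : ∀ i, IsCutSet (S i))
    (hequiv : ∀ (h : FreeGrp n) (i : I), ∃ j, S j = h • S i)
    (hg : ∀ i, g i ≠ 1)
    (haxis : ∀ i, S i = DecompositionSpace.proj M '' axisEnds (g i))
    (hcross : ∀ i j, ¬ Crosses (S i) (S j))
    (horbits : ∃ J : Set I, J.Finite ∧ ∀ i, ∃ j ∈ J, ∃ h : FreeGrp n, S i = h • S j) :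
    ∃ Γ : Splitting (FreeGrp n),
      Γ.IsRelativeTo M ∧ Γ.HasCyclicEdgeGroups ∧
      ∃ type₁ type₂ : Set Γ.V,
        -- the tree is bipartite, with classes invariant under the group
        IsCompl type₁ type₂ ∧
        (∀ u v, Γ.tree.Adj u v → (u ∈ type₁ ↔ v ∈ type₂)) ∧
        (∀ h : FreeGrp n, h • type₁ = type₁ ∧ h • type₂ = type₂) ∧
        -- Type 1 vertices correspond equivariantly to the cut sets `S i`, and the vertex of `S i`
        -- is stabilized by the maximal cyclic subgroup containing `g i`
        (∃ vtx : I → Γ.V, range vtx = type₁ ∧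
          (∀ i j, vtx i = vtx j ↔ S i = S j) ∧
          (∀ (h : FreeGrp n) (i j : I), S j = h • S i → vtx j = h • vtx i) ∧
          ∀ i, IsMaximalCyclic (Γ.vertexGroup (vtx i)) ∧ g i ∈ Γ.vertexGroup (vtx i)) ∧
        -- Type 2 vertices are stabilized by non-cyclic subgroups
        ∀ v ∈ type₂, ¬ IsCyclic (Γ.vertexGroup v) := by
  -- Walls are the sets `S i` and not the indices, so indices with the same set give a single
  -- vertex.
  let F : SubMulAction (FreeGrp n) (Set (DecompositionSpace M)) :=
    { carrier := range S
      smul_mem' := by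
        rintro h _ ⟨i, rfl⟩
        obtain ⟨j, hj⟩ := hequiv h i
        exact ⟨j, hj⟩ }
  have hF : IsWallFamily M F :=
    { two_le := hn
      ne_one := hM
      connected := hconn
      exists_axis := by
        rintro _ ⟨i, rfl⟩
        exact ⟨g i, hg i, haxis i⟩
      isCutSet := by
        rintro _ ⟨i, rfl⟩
        exact hcut i
      not_crosses := by
        rintro _ ⟨i, rfl⟩ _ ⟨j, rfl⟩
        exact hcross i j
      finite_orbits := by
        obtain ⟨J, hJ, h⟩ := horbits
        refine ⟨(fun j => ⟨S j, j, rfl⟩) '' J, hJ.image _, ?_⟩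
        rintro ⟨_, i, rfl⟩
        obtain ⟨j, hj, f, hf⟩ := h i
        exact ⟨_, mem_image_of_mem _ hj, f, Subtype.ext hf⟩
      nonempty := ‹Nonempty I›.map fun i => ⟨S i, i, rfl⟩ }
  have hstab : ∀ i, MulAction.stabilizer (FreeGrp n) (⟨S i, i, rfl⟩ : F) =
      Subgroup.centralizer {g i} := fun i => hF.stabilizer_eq _ (hg i) (haxis i)
  let Γ := hF.sideSystem.splitting
  have hinl : ∀ R : F, Γ.vertexGroup (Sum.inl R) = MulAction.stabilizer (FreeGrp n) R := by
    intro R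
    ext h
    exact Sum.inl_injective.eq_iff
  have hinr : ∀ o, Γ.vertexGroup (Sum.inr o) = MulAction.stabilizer (FreeGrp n) o := by
    intro o
    ext h
    exact Sum.inr_injective.eq_iff
  have hcyc : ∀ R : F, IsCyclic (Γ.vertexGroup (Sum.inl R)) := by
    rintro ⟨_, i, rfl⟩
    rw [hinl, hstab]
    exact (isMaximalCyclic_centralizer (hg i)).1
  refine ⟨Γ, ?_, ?_, range Sum.inl, range Sum.inr, isCompl_range_inl_range_inr, ?_, ?_,
    ⟨fun i => Sum.inl ⟨S i, i, rfl⟩, ?_, ?_, ?_, ?_⟩, ?_⟩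
  · intro w hw
    rcases hF.exists_smul_eq hw with ⟨R, hR⟩ | ⟨o, ho⟩
    · exact ⟨Sum.inl R, congrArg Sum.inl hR⟩
    · exact ⟨Sum.inr o, congrArg Sum.inr ho⟩
  · rintro u v ⟨R, o, -, ⟨rfl, rfl⟩ | ⟨rfl, rfl⟩⟩
    · have := hcyc R
      exact Subgroup.isCyclic_of_le (inf_le_left : _ ≤ Γ.vertexGroup (Sum.inl R))
    · have := hcyc R
      exact Subgroup.isCyclic_of_le (inf_le_right : _ ≤ Γ.vertexGroup (Sum.inl R))
  · rintro u v ⟨R, o, -, ⟨rfl, rfl⟩ | ⟨rfl, rfl⟩⟩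
    · exact ⟨fun _ => ⟨o, rfl⟩, fun _ => ⟨R, rfl⟩⟩
    · exact ⟨fun ⟨_, h⟩ => (nomatch h), fun ⟨_, h⟩ => (nomatch h)⟩
  · have key : ∀ (h : FreeGrp n), h • (range Sum.inl : Set Γ.V) ⊆ range Sum.inl ∧
        h • (range Sum.inr : Set Γ.V) ⊆ range Sum.inr := by
      intro h
      constructor
      · rintro _ ⟨_, ⟨R, rfl⟩, rfl⟩
        exact ⟨h • R, rfl⟩
      · rintro _ ⟨_, ⟨o, rfl⟩, rfl⟩
        exact ⟨h • o, rfl⟩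
    intro h
    refine ⟨(key h).1.antisymm ?_, (key h).2.antisymm ?_⟩
    · rw [subset_smul_set_iff]
      exact (key h⁻¹).1
    · rw [subset_smul_set_iff]
      exact (key h⁻¹).2
  · ext v
    constructor
    · rintro ⟨i, rfl⟩
      exact ⟨_, rfl⟩
    · rintro ⟨⟨_, i, rfl⟩, rfl⟩
      exact ⟨i, rfl⟩
  · intro i j
    exact ⟨fun h => congrArg Subtype.val (Sum.inl_injective h),
      fun h => congrArg Sum.inl (Subtype.ext h)⟩
  · intro h i j hij
    exact congrArg Sum.inl (Subtype.ext hij)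
  · intro i
    rw [hinl, hstab]
    exact ⟨isMaximalCyclic_centralizer (hg i), Subgroup.mem_centralizer_singleton_iff.2 rfl⟩
  · rintro _ ⟨o, rfl⟩
    rw [hinr]
    exact hF.not_isCyclic_stabilizer o
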